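/- **Setting.** Let $\varepsilon_1,\varepsilon_2,\dots$ be i.i.d. real processes indexed by $[0,1]$, centered and of second order, with common autocovariance function $R(t,s)=\mathrm{Cov}(\varepsilon_1(t),\varepsilon_1(s))$; let $g:[0,1]\to\mathbb R$ and $Y_j(t)=g(t)+\varepsilon_j(t)$. Let $f$ be a probability density on $[0,1]$ with $\inf_{[0,1]}f>0$ and $\sup_{[0,1]}f<\infty$, $F(t)=\int_0^t f$, and for $n\ge1$ let $T_n=\{F^{-1}(i/n): i=1,\dots,n\}$. For a kernel $K$ and a bandwidth $h\in(0,1)$ put $\varphi_{x,h}(t)=\frac1hK\big(\frac{x-t}{h}\big)$ and $\overline Y=\frac1m\sum_{j=1}^mY_j$, and define the trapezoidal estimator $$\hat g^{\rm trap}_{n}(x)=\frac1{2n}\sum_{k=1}^{N-1}\Big\{\Big(\frac{\varphi_{x,h}}{f}\overline Y\Big)(t_{x,k})+\Big(\frac{\varphi_{x,h}}{f}\overline Y\Big)(t_{x,k+1})\Big\},$$ where $t_{x,1}<\dots<t_{x,N}$ are the points of $T_n\cap[x-h,x+h]$ (the sum is $0$ if $N\le1$). **Assumptions.** (A) $R$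 is continuous on $[0,1]^2$. (B) The one-sided limits $R^{(0,1)}(t,t^-)=\lim_{s\uparrow t}\partial_sR(t,s)$ (for $0<t\le1$) and $R^{(0,1)}(t,t^+)=\lim_{s\downarrow t}\partial_sR(t,s)$ (for $0\le t<1$) exist and are continuous in $t$, and the jump function $\alpha(t)=R^{(0,1)}(t,t^-)-R^{(0,1)}(t,t^+)$ is continuous and not identically zero on $(0,1)$. (C) On $\{(t,s)\in[0,1]^2:t\ne s\}$ the function $R$ is of class $C^2$, with bounded partial derivatives $R^{(i,j)}$ for $0\le i+j\le2$; for each $t\in[0,1]$ the function $R^{(0,2)}(t,\cdot)$ is Lipschitz on $[0,t)$ and on $(t,1]$. (D) $K$ is even, $K(u)=0$ for $|u|\ge1$, $\int_{-1}^1K=1$, and $K\in C^2([-1,1])$ with $K''$ Lipschitz on $[-1,1]$ (one-sided derivatives at $\pm1$). (E) $f,g\in C^2([0,1])$, and $f''$, $g''$ are Lipschitz on $[0,1]$. **Theorem.** Assume (A)–(E). Let $n=n_k\to\infty$ and $m=m_k\to\infty$ be sequences of integers and $h=h_k\in(0,1)$ bandwidths such that, as $k\to\infty$, $h\to0$, $nh\to\infty$,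 $\sqrt m\,h^2\to0$ and $nh^2\to\infty$. Then for every $x\in(0,1)$, $$\sqrt m\,\big(\hat g^{\rm trap}_{n}(x)-g(x)\big)\ \xrightarrow{\ \mathcal D\ }\ \mathcal N\big(0,R(x,x)\big),$$ where $\mathcal N(0,0)$ is the point mass at $0$. -/

import Mathlib

open Set Filter Topology MeasureTheory ProbabilityTheory
open scoped NNReal ENNReal

noncomputable section

namespace TrapReg

/-- The second derivative of `u` on the interval `[a, b]` (one-sided at the end points). -/
def secondDeriv (a b : ℝ) (u : ℝ → ℝ) : ℝ → ℝ :=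
  iteratedDerivWithin 2 u (Icc a b)

/-- `u` is of class `C²` on `[a, b]` and its second derivative is Lipschitz there. -/
def IsC2Lipschitz (a b : ℝ) (u : ℝ → ℝ) : Prop :=
  ContDiffOn ℝ 2 u (Icc a b) ∧ ∃ L : ℝ≥0, LipschitzOnWith L (secondDeriv a b u) (Icc a b)

/-! ### The sampling design -/

/-- `f` is a probability density on `[0, 1]`, bounded away from zero and from infinity there. -/
structure IsDesignDensity (f : ℝ → ℝ) : Prop where
  integral_eq_one : ∫ t in (0 : ℝ)..1, f t = 1
  bounded_below : ∃ c : ℝ, 0 < c ∧ ∀ t ∈ Icc (0 : ℝ) 1, c ≤ f t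
  bounded_above : ∃ C : ℝ, ∀ t ∈ Icc (0 : ℝ) 1, f t ≤ C

/-- The distribution function `F(t) = ∫₀ᵗ f` for `t` in `[0, 1]`. -/
def distFun (f : ℝ → ℝ) (t : ℝ) : ℝ := ∫ u in (0 : ℝ)..t, f u

/-- The design point `t_{i,n} = F⁻¹(i / n)`, with `F` inverted on `[0, 1]` (for a density bounded
away from zero, `F` is a bijection of `[0, 1]` onto itself). -/
def designPoint (f : ℝ → ℝ) (n i : ℕ) : ℝ :=
  Function.invFunOn (distFun f) (Icc (0 : ℝ) 1) ((i : ℝ) / (n : ℝ))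

/-- The regular design `T_n = {t_{1,n}, …, t_{n,n}}`. -/
def design (f : ℝ → ℝ) (n : ℕ) : Finset ℝ :=
  (Finset.Icc 1 n).image (designPoint f n)

/-- The design points in the window, `T_n ∩ [x - h, x + h]`. -/
def window (f : ℝ → ℝ) (n : ℕ) (h x : ℝ) : Finset ℝ :=
  (design f n).filter fun t => x - h ≤ t ∧ t ≤ x + h

/-- The points of the window in increasing order, numbered from `0`. -/
def windowPoint (f : ℝ → ℝ) (n : ℕ) (h x : ℝ) : Fin (window f n h x).card ↪o ℝ :=
  (window f n h x).orderEmbOfFin rfl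

/-! ### The kernel -/

/-- An even kernel supported in `[-1, 1]`, vanishing at `±1`, of integral one, of class `C²` on
`[-1, 1]` with Lipschitz second derivative there. -/
structure IsKernel (K : ℝ → ℝ) : Prop where
  even : ∀ u, K (-u) = K u
  eq_zero : ∀ u, 1 ≤ |u| → K u = 0
  integral_eq_one : ∫ u in (-1 : ℝ)..1, K u = 1
  smooth : IsC2Lipschitz (-1) 1 K

/-- The rescaled kernel `φ_{x,h}(t) = h⁻¹ K((x - t) / h)`. -/
def scaledKernel (K : ℝ → ℝ) (x h t : ℝ) : ℝ := 1 / h * K ((x - t) / h)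

/-! ### The regression model and the estimator -/

/-- The observation `Y_j(t) = g(t) + ε_j(t)`. -/
def obs {Ω : Type*} (g : ℝ → ℝ) (ε : ℕ → ℝ → Ω → ℝ) (j : ℕ) (t : ℝ) (ω : Ω) : ℝ :=
  g t + ε j t ω

/-- The average of the first `m` observations at `t`. -/
def meanObs {Ω : Type*} (g : ℝ → ℝ) (ε : ℕ → ℝ → Ω → ℝ) (m : ℕ) (t : ℝ) (ω : Ω) : ℝ :=
  1 / (m : ℝ) * ∑ j ∈ Finset.range m, obs g ε j t ω

/-- The trapezoidal estimator at `x` from `n` design points and `m` experimental units with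
bandwidth `h`: the sum over consecutive points of `T_n ∩ [x - h, x + h]`. -/
def trapEstimator {Ω : Type*} (K f g : ℝ → ℝ) (ε : ℕ → ℝ → Ω → ℝ) (n m : ℕ) (h x : ℝ) (ω : Ω) :
    ℝ :=
  let ψ : ℝ → ℝ := fun t => scaledKernel K x h t / f t * meanObs g ε m t ω
  1 / (2 * (n : ℝ)) *
    ∑ k : Fin ((window f n h x).card - 1),
      (ψ (windowPoint f n h x ⟨k, by omega⟩) + ψ (windowPoint f n h x ⟨k + 1, by omega⟩))

/-! ### The error processes -/

/-- `ε 0, ε 1, …` are independent and identically distributed centered second order processes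
indexed by `[0, 1]` (as random elements of `ℝ^[0,1]` with its product σ-algebra). -/
structure IsErrorModel {Ω : Type*} [MeasurableSpace Ω] (P : Measure Ω) (ε : ℕ → ℝ → Ω → ℝ) :
    Prop where
  measurable : ∀ j, ∀ t ∈ Icc (0 : ℝ) 1, Measurable (ε j t)
  indep : iIndepFun (fun (j : ℕ) (ω : Ω) (t : Icc (0 : ℝ) 1) => ε j t ω) P
  ident : ∀ j, IdentDistrib (fun (ω : Ω) (t : Icc (0 : ℝ) 1) => ε j t ω)
    (fun (ω : Ω) (t : Icc (0 : ℝ) 1) => ε 0 t ω) P P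
  centered : ∀ j, ∀ t ∈ Icc (0 : ℝ) 1, ∫ ω, ε j t ω ∂P = 0
  second_order : ∀ j, ∀ t ∈ Icc (0 : ℝ) 1, MemLp (ε j t) 2 P

/-- The common autocovariance function `R(t, s) = Cov(ε(t), ε(s))`. -/
def autocov {Ω : Type*} [MeasurableSpace Ω] (P : Measure Ω) (ε : ℕ → ℝ → Ω → ℝ) (t s : ℝ) : ℝ :=
  cov[ε 0 t, ε 0 s; P]

/-! ### Regularity of the autocovariance function -/

/-- The mixed partial derivative `R^{(i,j)}(t, s)` on the unit square, of order `i` in the first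
and `j` in the second variable (one-sided on the boundary of the square). -/
def mixedPartial (R : ℝ → ℝ → ℝ) (i j : ℕ) (t s : ℝ) : ℝ :=
  iteratedDerivWithin i (fun u => iteratedDerivWithin j (fun v => R u v) (Icc (0 : ℝ) 1) s)
    (Icc (0 : ℝ) 1) t

/-- The unit square without its diagonal. -/
def offDiagonal : Set (ℝ × ℝ) :=
  {p | p.1 ∈ Icc (0 : ℝ) 1 ∧ p.2 ∈ Icc (0 : ℝ) 1 ∧ p.1 ≠ p.2}

/-- The assumptions on the autocovariance function. -/
structure IsRegularCov (R : ℝ → ℝ → ℝ) : Prop where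
  /-- `R` is continuous on the unit square. -/
  cont : ContinuousOn (fun p : ℝ × ℝ => R p.1 p.2) (Icc (0 : ℝ) 1 ×ˢ Icc (0 : ℝ) 1)
  /-- The one-sided derivatives `Rm(t) = R^{(0,1)}(t, t⁻)` and `Rp(t) = R^{(0,1)}(t, t⁺)` at the
  diagonal exist and are continuous; the jump function `Rm - Rp` is continuous and not identically
  zero. -/
  diag : ∃ Rm Rp : ℝ → ℝ,
    (∀ t ∈ Ioc (0 : ℝ) 1, Tendsto (fun s => mixedPartial R 0 1 t s) (𝓝[<] t) (𝓝 (Rm t))) ∧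
    (∀ t ∈ Ico (0 : ℝ) 1, Tendsto (fun s => mixedPartial R 0 1 t s) (𝓝[>] t) (𝓝 (Rp t))) ∧
    ContinuousOn Rm (Ioc (0 : ℝ) 1) ∧ ContinuousOn Rp (Ico (0 : ℝ) 1) ∧
    ContinuousOn (fun t => Rm t - Rp t) (Ioo (0 : ℝ) 1) ∧
    ∃ t ∈ Ioo (0 : ℝ) 1, Rm t - Rp t ≠ 0
  /-- Off the diagonal `R` is of class `C²`. -/
  offdiag_smooth : ContDiffOn ℝ 2 (fun p : ℝ × ℝ => R p.1 p.2) offDiagonal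
  /-- Off the diagonal the partial derivatives up to order two are bounded. -/
  offdiag_bounded : ∀ i j : ℕ, i + j ≤ 2 →
    ∃ A : ℝ, ∀ p ∈ offDiagonal, |mixedPartial R i j p.1 p.2| ≤ A
  /-- For every `t`, `R^{(0,2)}(t, ·)` is Lipschitz on each side of the diagonal. -/
  lipschitz : ∀ t ∈ Icc (0 : ℝ) 1, ∃ L : ℝ≥0,
    LipschitzOnWith L (fun s => mixedPartial R 0 2 t s) (Ico (0 : ℝ) t) ∧
    LipschitzOnWith L (fun s => mixedPartial R 0 2 t s) (Ioc t (1 : ℝ))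

end TrapReg

end

/-! The estimator is linear in the averaged data, so `sqrt_mul_trapEstimator_sub` splits the
normalized error exactly into three terms: the normalized sum of the errors `ε j x`, the normalized
sum of the smoothing errors (trapezoidal smoothing of `ε j` minus `ε j x`), and √m times the
deterministic bias. The classical central limit theorem handles the first and produces the limit;
Slutsky's lemma removes the other two.

Bias (`exists_abs_trapSum_sub_le`): up to O(h²), the kernel integral of `g` is `g x`, since an even
kernel kills the first-order term. The quantile design has cells of `F`-mass exactly 1/n, so the
estimator is a trapezoidal rule for `φ g / f` against the measure with density `f`. A cell
contributes O((nh)⁻³) and there are O(nh) cells; the two end cells are harmless because `K` vanishes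
at ±1. Hence a quadrature error O((nh)⁻²), which is at most O(h²) once nh² ≥ 1, and √m h² → 0
finishes.

Smoothing errors (`integral_smoothingError_sq_le`): the weights have bounded absolute sum, live
within distance h of `x`, and their total tends to 1 (the bias bound for the constant function 1).
Continuity of the covariance gives mean square continuity of the errors, so the smoothing error of
one unit tends to 0 in L². The units being independent and centered, dividing their sum by √m does
not raise the variance above that of one unit, and Chebyshev's inequality concludes. -/

namespace TrapReg

/-! ### Taylor bounds and the trapezoidal rule on one cell -/

/-- A first order Taylor expansion of `u` on `s`, uniform in the base point: `u` and `u'` are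
bounded by `A`, and the remainder is at most `A * (b - a) ^ 2`. -/
structure HasUniformTaylor (u u' : ℝ → ℝ) (s : Set ℝ) (A : ℝ) : Prop where
  bound : ∀ a ∈ s, |u a| ≤ A
  bound' : ∀ a ∈ s, |u' a| ≤ A
  taylor : ∀ a ∈ s, ∀ b ∈ s, |u b - u a - u' a * (b - a)| ≤ A * (b - a) ^ 2
  lip : ∀ a ∈ s, ∀ b ∈ s, |u b - u a| ≤ A * |b - a|
  cont : ContinuousOn u s

lemma HasUniformTaylor.mono {u u' : ℝ → ℝ} {s : Set ℝ} {A B : ℝ} (h : HasUniformTaylor u u' s A)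
    (hAB : A ≤ B) : HasUniformTaylor u u' s B where
  bound a ha := (h.bound a ha).trans hAB
  bound' a ha := (h.bound' a ha).trans hAB
  taylor a ha b hb := (h.taylor a ha b hb).trans (by gcongr)
  lip a ha b hb := (h.lip a ha b hb).trans (by gcongr)
  cont := h.cont

lemma exists_hasUniformTaylor {u : ℝ → ℝ} {a b : ℝ} (hab : a < b)
    (hu : ContDiffOn ℝ 2 u (Icc a b)) :
    ∃ u' A, 0 ≤ A ∧ HasUniformTaylor u u' (Icc a b) A := by
  have hs : UniqueDiffOn ℝ (Icc a b) := uniqueDiffOn_Icc hab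
  have hu' : ContDiffOn ℝ 1 (derivWithin u (Icc a b)) (Icc a b) :=
    hu.derivWithin hs (by norm_num)
  have hu'' : ContDiffOn ℝ 0 (derivWithin (derivWithin u (Icc a b)) (Icc a b)) (Icc a b) :=
    hu'.derivWithin hs (by norm_num)
  obtain ⟨A₀, hA₀⟩ := isCompact_Icc.exists_bound_of_continuousOn hu.continuousOn
  obtain ⟨A₁, hA₁⟩ := isCompact_Icc.exists_bound_of_continuousOn hu'.continuousOn
  obtain ⟨A₂, hA₂⟩ := isCompact_Icc.exists_bound_of_continuousOn hu''.continuousOn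
  have hd : DifferentiableOn ℝ u (Icc a b) := hu.differentiableOn (by norm_num)
  have hd' : DifferentiableOn ℝ (derivWithin u (Icc a b)) (Icc a b) :=
    hu'.differentiableOn (by norm_num)
  have hlip (s) (hs : s ∈ Icc a b) (t) (ht : t ∈ Icc a b) :
      |derivWithin u (Icc a b) t - derivWithin u (Icc a b) s| ≤ A₂ * |t - s| := by
    simpa using (convex_Icc a b).norm_image_sub_le_of_norm_derivWithin_le hd' hA₂ hs ht
  have h₂ : 0 ≤ A₂ := (norm_nonneg _).trans (hA₂ a (left_mem_Icc.2 hab.le))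
  refine ⟨derivWithin u (Icc a b), max A₀ (max A₁ A₂), by simp [h₂],
    fun s hs => (hA₀ s hs).trans (by simp), fun s hs => (hA₁ s hs).trans (by simp), ?_, ?_,
    hu.continuousOn⟩
  · intro s hs t ht
    have hsub : uIcc s t ⊆ Icc a b := by
      intro w hw
      rcases mem_uIcc.1 hw with h | h
      · exact ⟨hs.1.trans h.1, h.2.trans ht.2⟩
      · exact ⟨ht.1.trans h.1, h.2.trans hs.2⟩
    -- Mean value inequality for `u` minus its tangent at `s`, whose derivative is at most `A₂ * |t
    -- - s|` between `s` and `t`.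
    have key := (convex_uIcc s t).norm_image_sub_le_of_norm_hasDerivWithin_le
      (f := fun w => u w - derivWithin u (Icc a b) s * w)
      (f' := fun w => derivWithin u (Icc a b) w - derivWithin u (Icc a b) s * 1)
      (C := A₂ * |t - s|) (x := s) (y := t)
      (fun w hw => ((hd w (hsub hw)).hasDerivWithinAt.mono hsub).sub
        ((hasDerivWithinAt_id w _).const_mul _))
      (fun w hw => by
        rw [mul_one]
        refine (hlip s hs w (hsub hw)).trans ?_
        exact mul_le_mul_of_nonneg_left (abs_sub_left_of_mem_uIcc hw) h₂)
      left_mem_uIcc right_mem_uIcc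
    simp only [Real.norm_eq_abs] at key
    calc |u t - u s - derivWithin u (Icc a b) s * (t - s)|
        = |u t - derivWithin u (Icc a b) s * t - (u s - derivWithin u (Icc a b) s * s)| := by
          congr 1; ring
      _ ≤ A₂ * |t - s| * |t - s| := key
      _ = A₂ * (t - s) ^ 2 := by rw [mul_assoc, abs_mul_abs_self, sq]
      _ ≤ _ := by gcongr; simp
  · intro s hs t ht
    refine ((convex_Icc a b).norm_image_sub_le_of_norm_derivWithin_le hd hA₁ hs ht).trans ?_
    rw [Real.norm_eq_abs]
    gcongr
    simp

/-- The error of the trapezoidal rule on one cell, for the measure with density `f`. -/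
lemma abs_integral_mul_sub_trapezoid_le {f ψ : ℝ → ℝ} {s t C L D D' M : ℝ} (hst : s ≤ t)
    (hf : ContinuousOn f (Icc s t)) (hψ : ContinuousOn ψ (Icc s t))
    (hfC : ∀ u ∈ Icc s t, |f u| ≤ C) (hfL : ∀ u ∈ Icc s t, |f u - f s| ≤ L * |u - s|)
    (hψM : ∀ u ∈ Icc s t, |ψ u - ψ s - D * (u - s)| ≤ M * (u - s) ^ 2) (hM : 0 ≤ M) (hL : 0 ≤ L)
    (hD : |D| ≤ D') :
    |(∫ u in s..t, ψ u * f u) - (ψ s + ψ t) / 2 * ∫ u in s..t, f u|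
      ≤ (L * D' + 2 * C * M) * (t - s) ^ 3 := by
  have hf' : IntervalIntegrable f volume s t := hf.intervalIntegrable_of_Icc hst
  have hψf : IntervalIntegrable (fun u => ψ u * f u) volume s t :=
    (hψ.mul hf).intervalIntegrable_of_Icc hst
  -- To leading order the integrand is this linear function, which is odd about the midpoint.
  -- Subtracting its zero integral leaves a quadratic remainder, hence a cubic cell error.
  have hlin : IntervalIntegrable (fun u => D * f s * (u - (s + t) / 2)) volume s t :=
    Continuous.intervalIntegrable (by fun_prop) _ _
  have hlin0 : ∫ u in s..t, D * f s * (u - (s + t) / 2) = 0 := by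
    rw [intervalIntegral.integral_const_mul, intervalIntegral.integral_sub
      (Continuous.intervalIntegrable (by fun_prop) _ _) (by simp), integral_id]
    simp only [intervalIntegral.integral_const, smul_eq_mul]
    ring
  have heq : (∫ u in s..t, ψ u * f u) - (ψ s + ψ t) / 2 * ∫ u in s..t, f u =
      ∫ u in s..t, (ψ u * f u - (ψ s + ψ t) / 2 * f u - D * f s * (u - (s + t) / 2)) := by
    rw [intervalIntegral.integral_sub (hψf.sub (hf'.const_mul _)) hlin, hlin0,
      intervalIntegral.integral_sub hψf (hf'.const_mul _), intervalIntegral.integral_const_mul,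
      sub_zero]
  rw [heq]
  have hbd := intervalIntegral.norm_integral_le_of_norm_le_const (a := s) (b := t)
    (C := (L * D' + 2 * C * M) * (t - s) ^ 2)
    (f := fun u => ψ u * f u - (ψ s + ψ t) / 2 * f u - D * f s * (u - (s + t) / 2)) ?_
  · refine hbd.trans_eq ?_
    rw [abs_of_nonneg (sub_nonneg.2 hst)]
    ring
  · intro u hu
    rw [uIoc_of_le hst] at hu
    have hu : u ∈ Icc s t := ⟨hu.1.le, hu.2⟩
    have hr := hψM u hu
    have hrt := hψM t (right_mem_Icc.2 hst)
    have hC : 0 ≤ C := (abs_nonneg _).trans (hfC u hu)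
    have hD' : 0 ≤ D' := (abs_nonneg _).trans hD
    have hus : |u - s| ≤ t - s := by
      rw [abs_of_nonneg (by linarith [hu.1])]; linarith [hu.2]
    have hmid : |u - (s + t) / 2| ≤ t - s := by
      rw [abs_le]; constructor <;> linarith [hu.1, hu.2]
    have hsq : (u - s) ^ 2 ≤ (t - s) ^ 2 := by
      rw [← sq_abs (u - s)]; gcongr
    have hr' : |ψ u - ψ s - D * (u - s)| ≤ M * (t - s) ^ 2 := hr.trans (by gcongr)
    -- This is the Taylor remainder at `u` minus half of that at `t`; it equals ψ u minus the mean
    -- of the end values minus D times the distance to the midpoint. The bound 3/2 is rounded up to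
    -- 2.
    have h1 : |ψ u - ψ s - D * (u - s) - (ψ t - ψ s - D * (t - s)) / 2|
        ≤ 2 * (M * (t - s) ^ 2) := by
      rw [abs_le] at hr' hrt ⊢
      have : 0 ≤ M * (t - s) ^ 2 := by positivity
      constructor <;> linarith [hr'.1, hr'.2, hrt.1, hrt.2]
    have h2 : |f u - f s| ≤ L * (t - s) := (hfL u hu).trans (by gcongr)
    rw [Real.norm_eq_abs]
    calc |ψ u * f u - (ψ s + ψ t) / 2 * f u - D * f s * (u - (s + t) / 2)|
        = |D * ((u - (s + t) / 2) * (f u - f s))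
            + (ψ u - ψ s - D * (u - s) - (ψ t - ψ s - D * (t - s)) / 2) * f u| := by
          congr 1; ring
      _ ≤ |D| * (|u - (s + t) / 2| * |f u - f s|)
            + |ψ u - ψ s - D * (u - s) - (ψ t - ψ s - D * (t - s)) / 2| * |f u| := by
          rw [← abs_mul, ← abs_mul, ← abs_mul]; exact abs_add_le _ _
      _ ≤ D' * ((t - s) * (L * (t - s))) + 2 * (M * (t - s) ^ 2) * C := by
          gcongr
          exact hfC u hu
      _ = _ := by ring

/-! ### The quantile design and its window -/

section Design

variable {f : ℝ → ℝ} {c C : ℝ}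

lemma distFun_sub_distFun (hf : ContinuousOn f (Icc 0 1)) {s t : ℝ} (hs : s ∈ Icc (0 : ℝ) 1)
    (ht : t ∈ Icc (0 : ℝ) 1) : distFun f t - distFun f s = ∫ u in s..t, f u := by
  have hint {a b : ℝ} (ha : a ∈ Icc (0 : ℝ) 1) (hb : b ∈ Icc (0 : ℝ) 1) :
      IntervalIntegrable f volume a b :=
    (hf.mono (by
      intro w hw
      rcases mem_uIcc.1 hw with h | h
      · exact ⟨ha.1.trans h.1, h.2.trans hb.2⟩
      · exact ⟨hb.1.trans h.1, h.2.trans ha.2⟩)).intervalIntegrable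
  have h0 : (0 : ℝ) ∈ Icc (0 : ℝ) 1 := by simp
  exact intervalIntegral.integral_interval_sub_left (hint h0 ht) (hint h0 hs)

lemma mul_sub_le_distFun_sub (hf : ContinuousOn f (Icc 0 1))
    (hc : ∀ t ∈ Icc (0 : ℝ) 1, c ≤ f t) {s t : ℝ} (hs : s ∈ Icc (0 : ℝ) 1)
    (ht : t ∈ Icc (0 : ℝ) 1) (hst : s ≤ t) : c * (t - s) ≤ distFun f t - distFun f s := by
  have hsub : Icc s t ⊆ Icc (0 : ℝ) 1 := Icc_subset_Icc hs.1 ht.2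
  rw [distFun_sub_distFun hf hs ht]
  have := intervalIntegral.integral_mono_on (f := fun _ => c) hst
    (intervalIntegrable_const (μ := volume))
    ((hf.mono hsub).intervalIntegrable_of_Icc hst) (fun u hu => hc u (hsub hu))
  simpa [mul_comm] using this

lemma distFun_sub_le_mul_sub (hf : ContinuousOn f (Icc 0 1))
    (hC : ∀ t ∈ Icc (0 : ℝ) 1, f t ≤ C) {s t : ℝ} (hs : s ∈ Icc (0 : ℝ) 1)
    (ht : t ∈ Icc (0 : ℝ) 1) (hst : s ≤ t) : distFun f t - distFun f s ≤ C * (t - s) := by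
  have hsub : Icc s t ⊆ Icc (0 : ℝ) 1 := Icc_subset_Icc hs.1 ht.2
  rw [distFun_sub_distFun hf hs ht]
  have := intervalIntegral.integral_mono_on (g := fun _ => C) hst
    ((hf.mono hsub).intervalIntegrable_of_Icc hst)
    (intervalIntegrable_const (μ := volume)) (fun u hu => hC u (hsub hu))
  simpa [mul_comm] using this

lemma distFun_strictMonoOn (hf : ContinuousOn f (Icc 0 1)) (hc0 : 0 < c)
    (hc : ∀ t ∈ Icc (0 : ℝ) 1, c ≤ f t) : StrictMonoOn (distFun f) (Icc 0 1) := by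
  intro s hs t ht hst
  have := mul_sub_le_distFun_sub hf hc hs ht hst.le
  have : 0 < c * (t - s) := mul_pos hc0 (sub_pos.2 hst)
  linarith

lemma distFun_zero : distFun f 0 = 0 := by simp [distFun]

lemma distFun_surjOn (hf : ContinuousOn f (Icc 0 1)) (h1 : ∫ t in (0 : ℝ)..1, f t = 1) :
    SurjOn (distFun f) (Icc 0 1) (Icc 0 1) := by
  have hcont : ContinuousOn (distFun f) (Icc 0 1) :=
    intervalIntegral.continuousOn_primitive (hf.integrableOn_Icc (μ := volume)) |>.congr
      fun t ht => by rw [distFun, intervalIntegral.integral_of_le ht.1]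
  have := intermediate_value_Icc zero_le_one hcont
  rwa [distFun_zero, show distFun f 1 = 1 from h1] at this

lemma designPoint_mem (hf : ContinuousOn f (Icc 0 1)) (h1 : ∫ t in (0 : ℝ)..1, f t = 1)
    {n i : ℕ} (hin : i ≤ n) : designPoint f n i ∈ Icc (0 : ℝ) 1 :=
  Function.invFunOn_mem (distFun_surjOn hf h1 ⟨by positivity,
    div_le_one_of_le₀ (by exact_mod_cast hin) (by positivity)⟩)

lemma distFun_designPoint (hf : ContinuousOn f (Icc 0 1)) (h1 : ∫ t in (0 : ℝ)..1, f t = 1)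
    {n i : ℕ} (hin : i ≤ n) : distFun f (designPoint f n i) = i / n :=
  Function.invFunOn_eq (distFun_surjOn hf h1 ⟨by positivity,
    div_le_one_of_le₀ (by exact_mod_cast hin) (by positivity)⟩)

lemma mem_window {n : ℕ} {h x t : ℝ} : t ∈ window f n h x ↔
    (∃ i, 1 ≤ i ∧ i ≤ n ∧ designPoint f n i = t) ∧ x - h ≤ t ∧ t ≤ x + h := by
  simp [window, design, and_assoc]

lemma windowPoint_mem {n : ℕ} {h x : ℝ} (k : Fin (window f n h x).card) :
    windowPoint f n h x k ∈ window f n h x :=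
  Finset.orderEmbOfFin_mem _ rfl k

lemma exists_windowPoint_eq {n : ℕ} {h x t : ℝ} (ht : t ∈ window f n h x) :
    ∃ k, windowPoint f n h x k = t := by
  have : t ∈ Set.range (windowPoint f n h x) := by
    rw [windowPoint, Finset.range_orderEmbOfFin]; exact ht
  exact this

lemma mem_Icc_of_mem_window (hf : ContinuousOn f (Icc 0 1)) (h1 : ∫ t in (0 : ℝ)..1, f t = 1)
    {n : ℕ} {h x t : ℝ} (ht : t ∈ window f n h x) : t ∈ Icc (0 : ℝ) 1 := by
  obtain ⟨⟨i, -, hin, rfl⟩, -⟩ := mem_window.1 ht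
  exact designPoint_mem hf h1 hin

/-- The weighted sum that defines the trapezoidal estimator, as a functional of the averaged
observations `y`. -/
noncomputable def trapSum (K f : ℝ → ℝ) (n : ℕ) (h x : ℝ) (y : ℝ → ℝ) : ℝ :=
  1 / (2 * (n : ℝ)) *
    ∑ k : Fin ((window f n h x).card - 1),
      (scaledKernel K x h (windowPoint f n h x ⟨k, by omega⟩)
          / f (windowPoint f n h x ⟨k, by omega⟩) * y (windowPoint f n h x ⟨k, by omega⟩) +
        scaledKernel K x h (windowPoint f n h x ⟨k + 1, by omega⟩)
          / f (windowPoint f n h x ⟨k + 1, by omega⟩) * y (windowPoint f n h x ⟨k + 1, by omega⟩))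

/-- The window as a partition of `[x - h, x + h]` into cells of `F`-mass `1 / n`, up to two end
cells of mass at most `1 / n`. -/
structure IsWindowPartition (f : ℝ → ℝ) (n : ℕ) (h x : ℝ) (p : ℕ) (τ : ℕ → ℝ) : Prop where
  lt : ∀ k < p, τ k < τ (k + 1)
  mem : ∀ k ≤ p, τ k ∈ Icc (x - h) (x + h)
  mass : ∀ k < p, distFun f (τ (k + 1)) - distFun f (τ k) = 1 / n
  left : distFun f (τ 0) - distFun f (x - h) ≤ 1 / n
  right : distFun f (x + h) - distFun f (τ p) ≤ 1 / n

/-- Since `F` is increasing and takes the value i/n at the i-th design point, neighbours in the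
window have consecutive indices. The last hypothesis forces the window to have mass at least 1/n,
hence to be nonempty, so that `card - 1` is not truncated. -/
lemma exists_isWindowPartition (hf : ContinuousOn f (Icc 0 1)) (h1 : ∫ t in (0 : ℝ)..1, f t = 1)
    (hc0 : 0 < c) (hc : ∀ t ∈ Icc (0 : ℝ) 1, c ≤ f t) {n : ℕ} {h x : ℝ} (hn : 0 < n) (hh : 0 < h)
    (hxl : 0 < x - h) (hxr : x + h < 1) (hnh : 1 ≤ n * (c * (2 * h))) :
    ∃ τ : ℕ → ℝ, IsWindowPartition f n h x ((window f n h x).card - 1) τ ∧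
      ∀ K y, trapSum K f n h x y =
      1 / (2 * (n : ℝ)) * ∑ k ∈ Finset.range ((window f n h x).card - 1),
        (scaledKernel K x h (τ k) / f (τ k) * y (τ k) +
          scaledKernel K x h (τ (k + 1)) / f (τ (k + 1)) * y (τ (k + 1))) := by
  have hmono := distFun_strictMonoOn hf hc0 hc
  have hn' : (0 : ℝ) < n := by exact_mod_cast hn
  have hl : x - h ∈ Icc (0 : ℝ) 1 := ⟨hxl.le, by linarith⟩
  have hr : x + h ∈ Icc (0 : ℝ) 1 := ⟨by linarith, hxr.le⟩
  have hFl : 0 < distFun f (x - h) := by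
    rw [← distFun_zero (f := f)]; exact hmono (by simp) hl hxl
  have hFr : distFun f (x + h) < 1 := by
    rw [← show distFun f 1 = 1 from h1]; exact hmono hr (by simp) hxr
  have hmemI {i : ℕ} (hi : i ≤ n) (h1' : distFun f (x - h) ≤ i / n)
      (h2' : (i : ℝ) / n ≤ distFun f (x + h)) : designPoint f n i ∈ window f n h x := by
    have hd := designPoint_mem hf h1 hi
    rw [← distFun_designPoint hf h1 hi] at h1' h2'
    refine mem_window.2 ⟨⟨i, ?_, hi, rfl⟩, (hmono.le_iff_le hl hd).1 h1',
      (hmono.le_iff_le hd hr).1 h2'⟩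
    -- Index 0 is not in the design; it is excluded because `F` is positive at `x - h`.
    rcases Nat.eq_zero_or_pos i with rfl | h
    · rw [distFun_designPoint hf h1 hi] at h1'
      simp at h1'; linarith
    · exact h
  have hmass := mul_sub_le_distFun_sub hf hc hl hr (by linarith)
  have hcard : 0 < (window f n h x).card := by
    have hceil := Nat.ceil_lt_add_one (a := n * distFun f (x - h)) (by positivity)
    have hle := Nat.le_ceil (n * distFun f (x - h))
    have hle2 : (⌈n * distFun f (x - h)⌉₊ : ℝ) ≤ n * distFun f (x + h) := by
      have : n * (c * (2 * h)) ≤ n * (distFun f (x + h) - distFun f (x - h)) := by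
        refine mul_le_mul_of_nonneg_left ?_ hn'.le
        refine le_trans (le_of_eq ?_) hmass; ring
      linarith
    refine Finset.card_pos.2 ⟨_, hmemI (i := ⌈n * distFun f (x - h)⌉₊) ?_ ?_ ?_⟩
    · have : (⌈n * distFun f (x - h)⌉₊ : ℝ) ≤ n := hle2.trans (by nlinarith)
      exact_mod_cast this
    · rw [le_div_iff₀ hn']; linarith
    · rw [div_le_iff₀ hn']; linarith
  set N := (window f n h x).card with hN
  -- The value 0 past the last point is never used; it only lets the points be indexed by naturals.
  let τ : ℕ → ℝ := fun k => if hk : k < N then windowPoint f n h x ⟨k, hk⟩ else 0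
  have hτ {k : ℕ} (hk : k < N) : τ k = windowPoint f n h x ⟨k, hk⟩ := dif_pos hk
  have hτmem {k : ℕ} (hk : k < N) : τ k ∈ window f n h x := by
    rw [hτ hk]; exact windowPoint_mem _
  have hτlt {k l : ℕ} (hk : k < N) (hl : l < N) : τ k < τ l ↔ k < l := by
    rw [hτ hk, hτ hl, (windowPoint f n h x).lt_iff_lt, Fin.mk_lt_mk]
  have hidx {t : ℝ} (ht : t ∈ window f n h x) : ∃ k < N, τ k = t := by
    obtain ⟨k, hk⟩ := exists_windowPoint_eq ht
    exact ⟨k, k.2, by rw [hτ k.2]; exact hk⟩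
  have hF {i j : ℕ} (hi : i ≤ n) (hj : j ≤ n) :
      designPoint f n i < designPoint f n j ↔ i < j := by
    rw [← hmono.lt_iff_lt (designPoint_mem hf h1 hi) (designPoint_mem hf h1 hj),
      distFun_designPoint hf h1 hi, distFun_designPoint hf h1 hj, div_lt_div_iff_of_pos_right hn',
      Nat.cast_lt]
  refine ⟨τ, ⟨?_, ?_, ?_, ?_, ?_⟩, ?_⟩
  · intro k hk
    exact (hτlt (by omega) (by omega)).2 (by omega)
  · intro k hk
    exact (mem_window.1 (hτmem (k := k) (by omega))).2
  · intro k hk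
    have hk0 : k < N := by omega
    have hk1 : k + 1 < N := by omega
    obtain ⟨⟨i, hi1, hin, hi⟩, hil, hir⟩ := mem_window.1 (hτmem hk0)
    obtain ⟨⟨j, hj1, hjn, hj⟩, hjl, hjr⟩ := mem_window.1 (hτmem hk1)
    have hij : i < j := by
      rw [← hF hin hjn, hi, hj]; exact (hτlt hk0 hk1).2 (by omega)
    -- Otherwise design point `i + 1` would lie strictly between two adjacent points of the window.
    have hji : j = i + 1 := by
      by_contra hne
      have hi2 : i + 1 < j := by omega
      have hin2 : i + 1 ≤ n := by omega
      have ha : τ k < designPoint f n (i + 1) := by rw [← hi, hF hin hin2]; omega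
      have hb : designPoint f n (i + 1) < τ (k + 1) := by rw [← hj, hF hin2 hjn]; exact hi2
      obtain ⟨l, hl, hl'⟩ := hidx (t := designPoint f n (i + 1))
        (mem_window.2 ⟨⟨i + 1, by omega, hin2, rfl⟩, by linarith, by linarith⟩)
      rw [← hl'] at ha hb
      have := (hτlt hk0 hl).1 ha
      have := (hτlt hl hk1).1 hb
      omega
    rw [← hi, ← hj, distFun_designPoint hf h1 hin, distFun_designPoint hf h1 hjn, hji]
    push_cast
    ring
  · obtain ⟨⟨i, hi1, hin, hi⟩, hil, hir⟩ := mem_window.1 (hτmem hcard)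
    rw [← hi, distFun_designPoint hf h1 hin]
    -- Otherwise design point `i - 1` would also be in the window, below its smallest point.
    by_contra! hcon
    have hi' : ((i - 1 : ℕ) : ℝ) / n = i / n - 1 / n := by
      rw [Nat.cast_sub hi1]; push_cast; ring
    have hle : designPoint f n (i - 1) < designPoint f n i :=
      (hF (by omega) hin).2 (by omega)
    have hmem := hmemI (i := i - 1) (by omega) (by rw [hi']; linarith) (by
      rw [← distFun_designPoint hf h1 (by omega : i - 1 ≤ n)]
      refine hmono.monotoneOn (designPoint_mem hf h1 (by omega)) hr ?_
      linarith)
    obtain ⟨l, hl, hl'⟩ := hidx hmem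
    rw [hi, ← hl'] at hle
    have := (hτlt hl hcard).1 hle
    omega
  · have hlast : N - 1 < N := by omega
    obtain ⟨⟨i, hi1, hin, hi⟩, hil, hir⟩ := mem_window.1 (hτmem hlast)
    rw [← hi, distFun_designPoint hf h1 hin]
    by_contra! hcon
    have hi' : ((i + 1 : ℕ) : ℝ) / n = i / n + 1 / n := by push_cast; ring
    have hin2 : i + 1 ≤ n := by
      have : ((i + 1 : ℕ) : ℝ) / n < 1 := by rw [hi']; linarith
      rw [div_lt_one hn'] at this
      exact_mod_cast this.le
    have hle : designPoint f n i < designPoint f n (i + 1) := (hF hin hin2).2 (by omega)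
    have hmem := hmemI hin2 (by
      rw [← distFun_designPoint hf h1 hin2]
      refine hmono.monotoneOn hl (designPoint_mem hf h1 hin2) ?_
      linarith) (by rw [hi']; linarith)
    obtain ⟨l, hl, hl'⟩ := hidx hmem
    rw [hi, ← hl'] at hle
    have := (hτlt hlast hl).1 hle
    omega
  · intro K y
    rw [trapSum, Finset.sum_range]
    congr 1
    refine Finset.sum_congr rfl fun k _ => ?_
    rw [hτ (k := k) (by omega), hτ (k := k + 1) (by omega)]

end Design

end TrapReg
namespace TrapReg

/-! ### The rescaled kernel: Taylor bounds, smoothing bias, decay at the edges -/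

lemma sub_div_mem_Icc {x h u : ℝ} (hh : 0 < h) (hu : u ∈ Icc (x - h) (x + h)) :
    (x - u) / h ∈ Icc (-1 : ℝ) 1 := by
  constructor
  · rw [le_div_iff₀ hh]; linarith [hu.2]
  · rw [div_le_iff₀ hh]; linarith [hu.1]

/-- The uniform Taylor expansion of a smooth function times the rescaled kernel. -/
lemma HasUniformTaylor.scaledKernel_mul {K K' q q' : ℝ → ℝ} {A x h : ℝ}
    (hK : HasUniformTaylor K K' (Icc (-1) 1) A) (hq : HasUniformTaylor q q' (Icc 0 1) A)
    (hh : 0 < h) (hh1 : h < 1) (hxl : 0 < x - h) (hxr : x + h < 1) :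
    ∀ s ∈ Icc (x - h) (x + h), ∃ D, |D| ≤ 2 * A ^ 2 / h ^ 2 ∧ ∀ u ∈ Icc (x - h) (x + h),
      |scaledKernel K x h u * q u - scaledKernel K x h s * q s - D * (u - s)|
        ≤ 3 * A ^ 2 / h ^ 3 * (u - s) ^ 2 := by
  intro s hs
  have hsub : Icc (x - h) (x + h) ⊆ Icc (0 : ℝ) 1 := Icc_subset_Icc hxl.le hxr.le
  have hsK := sub_div_mem_Icc hh hs
  have hA : 0 ≤ A := (abs_nonneg _).trans (hK.bound _ hsK)
  have hk0 := hK.bound _ hsK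
  have hk1 := hK.bound' _ hsK
  have hq0 := hq.bound _ (hsub hs)
  have hq1 := hq.bound' _ (hsub hs)
  -- The slope given by the product rule; its `K'` term is the one of order h⁻², and h < 1 absorbs
  -- the other.
  refine ⟨1 / h * (K ((x - s) / h) * q' s - K' ((x - s) / h) / h * q s), ?_, fun u hu => ?_⟩
  · rw [abs_mul, abs_of_pos (by positivity)]
    calc 1 / h * |K ((x - s) / h) * q' s - K' ((x - s) / h) / h * q s|
        ≤ 1 / h * (A * A + A / h * A) := by
          gcongr
          refine (abs_sub _ _).trans ?_
          rw [abs_mul, abs_mul, abs_div, abs_of_pos hh]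
          gcongr
      _ ≤ 1 / h * (A * A / h + A / h * A) := by
          gcongr
          rw [le_div_iff₀ hh]
          exact mul_le_of_le_one_right (by positivity) hh1.le
      _ = _ := by field_simp; ring
  · have hku := hK.taylor _ hsK _ (sub_div_mem_Icc hh hu)
    have hqu := hq.taylor _ (hsub hs) _ (hsub hu)
    have hql := hq.lip _ (hsub hs) _ (hsub hu)
    have hqb := hq.bound _ (hsub hu)
    have hd : (x - u) / h - (x - s) / h = -((u - s) / h) := by ring
    rw [hd] at hku
    set k0 := K ((x - s) / h)
    set k1 := K' ((x - s) / h)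
    set ku := K ((x - u) / h)
    set d := u - s
    -- The remainder of a product: remainder of the kernel, remainder of `q`, and a cross term with
    -- one increment of `q`.
    have hid : scaledKernel K x h u * q u - scaledKernel K x h s * q s
          - 1 / h * (k0 * q' s - k1 / h * q s) * d =
        1 / h * ((ku - k0 - k1 * -(d / h)) * q u + k0 * (q u - q s - q' s * d)
          - k1 * ((d / h) * (q u - q s))) := by
      simp only [scaledKernel, k0, k1, ku]
      field_simp
      ring
    have hd2 : |d| * |d| = d ^ 2 := by rw [abs_mul_abs_self, sq]
    rw [hid, abs_mul, abs_of_pos (by positivity : 0 < 1 / h)]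
    calc 1 / h * |(ku - k0 - k1 * -(d / h)) * q u + k0 * (q u - q s - q' s * d)
          - k1 * ((d / h) * (q u - q s))|
        ≤ 1 / h * (A * (-(d / h)) ^ 2 * A + A * (A * d ^ 2) + A * (|d| / h * (A * |d|))) := by
          gcongr
          refine (abs_sub _ _).trans (add_le_add ((abs_add_le _ _).trans ?_) ?_)
          · rw [abs_mul, abs_mul]
            gcongr
          · rw [abs_mul, abs_mul, abs_div, abs_of_pos hh]
            gcongr
      _ = A ^ 2 * d ^ 2 / h * (1 / h ^ 2 + 1 + 1 / h) := by
          have : A * (|d| / h * (A * |d|)) = A ^ 2 / h * (|d| * |d|) := by ring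
          rw [this, hd2]
          field_simp
      _ ≤ A ^ 2 * d ^ 2 / h * (1 / h ^ 2 + 1 / h ^ 2 + 1 / h ^ 2) := by
          gcongr
          · rw [le_div_iff₀ (by positivity), one_mul]
            exact pow_le_one₀ hh.le hh1.le
          · rw [sq]
            exact mul_le_of_le_one_right hh.le hh1.le
      _ = _ := by field_simp; ring

lemma IsKernel.continuousOn {K : ℝ → ℝ} (hK : IsKernel K) : ContinuousOn K (Icc (-1) 1) :=
  hK.smooth.1.continuousOn

/-- The integrand is odd. This vanishing first moment removes the order h term of the bias. -/
lemma IsKernel.integral_mul_id {K : ℝ → ℝ} (hK : IsKernel K) :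
    ∫ u in (-1 : ℝ)..1, K u * u = 0 := by
  have h := intervalIntegral.integral_comp_neg (a := -1) (b := 1) (fun u => K u * u)
  simp only [hK.even, mul_neg, neg_neg, intervalIntegral.integral_neg] at h
  linarith

/-- Convolving with an even kernel reproduces a smooth function up to order `h ^ 2`. -/
lemma IsKernel.abs_integral_scaledKernel_mul_sub_le {K K' g g' : ℝ → ℝ} {A x h : ℝ}
    (hK : IsKernel K) (hKT : HasUniformTaylor K K' (Icc (-1) 1) A)
    (hg : HasUniformTaylor g g' (Icc 0 1) A)
    (hh : 0 < h) (hxl : 0 < x - h) (hxr : x + h < 1) :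
    |(∫ u in (x - h)..(x + h), scaledKernel K x h u * g u) - g x| ≤ 2 * A ^ 2 * h ^ 2 := by
  have hx : x ∈ Icc (0 : ℝ) 1 := ⟨by linarith, by linarith⟩
  have hmem {v : ℝ} (hv : v ∈ Icc (-1 : ℝ) 1) : x - h * v ∈ Icc (0 : ℝ) 1 :=
    ⟨by nlinarith [hv.2], by nlinarith [hv.1]⟩
  have hsubst : ∫ u in (x - h)..(x + h), scaledKernel K x h u * g u =
      ∫ v in (-1 : ℝ)..1, K v * g (x - h * v) := by
    have := intervalIntegral.integral_comp_sub_mul (a := -1) (b := 1)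
      (fun u => scaledKernel K x h u * g u) hh.ne' x
    simp only [mul_one, mul_neg, sub_neg_eq_add, smul_eq_mul] at this
    rw [eq_inv_mul_iff_mul_eq₀ hh.ne'] at this
    rw [← this, ← intervalIntegral.integral_const_mul]
    refine intervalIntegral.integral_congr fun v _ => ?_
    simp only [scaledKernel]
    rw [show (x - (x - h * v)) / h = v by field_simp; ring]
    field_simp
  have hi1 : IntervalIntegrable (fun v => K v * g (x - h * v)) volume (-1) 1 := by
    refine ContinuousOn.intervalIntegrable_of_Icc (by norm_num) (hK.continuousOn.mul ?_)
    exact hg.cont.comp (by fun_prop) fun v hv => hmem hv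
  have hi2 : IntervalIntegrable (fun v => g x * K v) volume (-1) 1 :=
    (hK.continuousOn.intervalIntegrable_of_Icc (by norm_num)).const_mul _
  have hi3 : IntervalIntegrable (fun v => g' x * h * (K v * v)) volume (-1) 1 :=
    ((hK.continuousOn.mul continuousOn_id).intervalIntegrable_of_Icc (by norm_num)).const_mul _
  -- The added first-order term integrates to 0, so the integrand becomes `K` times the Taylor
  -- remainder of `g`.
  have heq : (∫ u in (x - h)..(x + h), scaledKernel K x h u * g u) - g x =
      ∫ v in (-1 : ℝ)..1, (K v * g (x - h * v) - g x * K v + g' x * h * (K v * v)) := by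
    rw [intervalIntegral.integral_add (hi1.sub hi2) hi3, intervalIntegral.integral_sub hi1 hi2,
      intervalIntegral.integral_const_mul, intervalIntegral.integral_const_mul,
      hK.integral_mul_id, hK.integral_eq_one, hsubst]
    ring
  rw [heq, ← Real.norm_eq_abs]
  refine (intervalIntegral.norm_integral_le_of_norm_le_const (C := A ^ 2 * h ^ 2)
    fun v hv => ?_).trans_eq ?_
  · rw [uIoc_of_le (by norm_num)] at hv
    have hv : v ∈ Icc (-1 : ℝ) 1 := ⟨hv.1.le, hv.2⟩
    have hKv := hKT.bound v hv
    have ht := hg.taylor x hx _ (hmem hv)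
    have hv2 : v ^ 2 ≤ 1 := by
      rw [sq_le_one_iff_abs_le_one, abs_le]; exact hv
    have hA : 0 ≤ A := (abs_nonneg _).trans hKv
    rw [Real.norm_eq_abs]
    calc |K v * g (x - h * v) - g x * K v + g' x * h * (K v * v)|
        = |K v| * |g (x - h * v) - g x - g' x * (x - h * v - x)| := by
          rw [← abs_mul]; congr 1; ring
      _ ≤ A * (A * (x - h * v - x) ^ 2) := by gcongr
      _ = A ^ 2 * h ^ 2 * v ^ 2 := by ring
      _ ≤ _ := mul_le_of_le_one_right (by positivity) hv2
  · norm_num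
    ring

lemma abs_scaledKernel_le {K K' : ℝ → ℝ} {A x h u : ℝ}
    (hK : HasUniformTaylor K K' (Icc (-1) 1) A) (hh : 0 < h) (hu : u ∈ Icc (x - h) (x + h)) :
    |scaledKernel K x h u| ≤ A / h := by
  rw [scaledKernel, abs_mul, abs_of_pos (by positivity)]
  have := hK.bound _ (sub_div_mem_Icc hh hu)
  calc 1 / h * |K ((x - u) / h)| ≤ 1 / h * A := by gcongr
    _ = A / h := by ring

/-- The rescaled kernel is small near the end points of its support. -/
lemma IsKernel.abs_scaledKernel_le_of_dist_le {K K' : ℝ → ℝ} {A x h u e d : ℝ} (hK : IsKernel K)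
    (hKT : HasUniformTaylor K K' (Icc (-1) 1) A) (hh : 0 < h) (hu : u ∈ Icc (x - h) (x + h))
    (he : |x - e| = h) (hue : |u - e| ≤ d) :
    |scaledKernel K x h u| ≤ A * d / h ^ 2 := by
  have he' : |(x - e) / h| = 1 := by rw [abs_div, he, abs_of_pos hh, div_self hh.ne']
  have hKe : K ((x - e) / h) = 0 := hK.eq_zero _ he'.ge
  have huK := sub_div_mem_Icc hh hu
  have hA : 0 ≤ A := (abs_nonneg _).trans (hKT.bound _ huK)
  have hl := hKT.lip ((x - e) / h) (abs_le.1 he'.le) _ huK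
  rw [hKe, sub_zero, show (x - u) / h - (x - e) / h = -((u - e) / h) by ring, abs_neg, abs_div,
    abs_of_pos hh] at hl
  rw [scaledKernel, abs_mul, abs_of_pos (by positivity)]
  calc 1 / h * |K ((x - u) / h)| ≤ 1 / h * (A * (d / h)) := by
        gcongr
        exact hl.trans (by gcongr)
    _ = _ := by field_simp

/-! ### Global quadrature error and bias -/

section Window

variable {f : ℝ → ℝ} {c C : ℝ}

/-- A density at least `c` turns mass at most 1/n into length at most 1/(cn). -/
lemma IsWindowPartition.sub_le {n p : ℕ} {h x : ℝ} {τ : ℕ → ℝ}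
    (hτ : IsWindowPartition f n h x p τ) (hf : ContinuousOn f (Icc 0 1)) (hc0 : 0 < c)
    (hc : ∀ t ∈ Icc (0 : ℝ) 1, c ≤ f t) (hn : 0 < n) (hxl : 0 < x - h) (hxr : x + h < 1) :
    (∀ k < p, τ (k + 1) - τ k ≤ 1 / (c * n)) ∧ τ 0 - (x - h) ≤ 1 / (c * n) ∧
      x + h - τ p ≤ 1 / (c * n) := by
  have hn' : (0 : ℝ) < n := by exact_mod_cast hn
  have key {s t : ℝ} (hs : s ∈ Icc (x - h) (x + h)) (ht : t ∈ Icc (x - h) (x + h)) (hst : s ≤ t)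
      (hF : distFun f t - distFun f s ≤ 1 / n) : t - s ≤ 1 / (c * n) := by
    have hsub : Icc (x - h) (x + h) ⊆ Icc (0 : ℝ) 1 := Icc_subset_Icc hxl.le hxr.le
    have := (mul_sub_le_distFun_sub hf hc (hsub hs) (hsub ht) hst).trans hF
    rw [le_div_iff₀ hn'] at this
    rw [le_div_iff₀ (by positivity)]
    linarith
  have hne : x - h ≤ x + h := (hτ.mem 0 (by omega)).1.trans (hτ.mem 0 (by omega)).2
  refine ⟨fun k hk => key (hτ.mem k hk.le) (hτ.mem (k + 1) hk) (hτ.lt k hk).le (hτ.mass k hk).le,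
    key (left_mem_Icc.2 hne) (hτ.mem 0 (by omega)) (hτ.mem 0 (by omega)).1 hτ.left,
    key (hτ.mem p le_rfl) (right_mem_Icc.2 hne) (hτ.mem p le_rfl).2 hτ.right⟩

/-- The cells have mass 1/n each and fit in a window of mass at most 2Ch. -/
lemma IsWindowPartition.card_le {n p : ℕ} {h x : ℝ} {τ : ℕ → ℝ}
    (hτ : IsWindowPartition f n h x p τ) (hf : ContinuousOn f (Icc 0 1)) (hc0 : 0 < c)
    (hc : ∀ t ∈ Icc (0 : ℝ) 1, c ≤ f t) (hC : ∀ t ∈ Icc (0 : ℝ) 1, f t ≤ C) (hn : 0 < n)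
    (hxl : 0 < x - h) (hxr : x + h < 1) : (p : ℝ) ≤ 2 * C * (n * h) := by
  have hn' : (0 : ℝ) < n := by exact_mod_cast hn
  have hsub : Icc (x - h) (x + h) ⊆ Icc (0 : ℝ) 1 := Icc_subset_Icc hxl.le hxr.le
  have hmono := (distFun_strictMonoOn hf hc0 hc).monotoneOn
  have hne : x - h ≤ x + h := (hτ.mem 0 (by omega)).1.trans (hτ.mem 0 (by omega)).2
  have hsum : (p : ℝ) * (1 / n) = distFun f (τ p) - distFun f (τ 0) := by
    rw [← Finset.sum_range_sub (fun k => distFun f (τ k)), Finset.sum_congr rfl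
      fun k hk => hτ.mass k (Finset.mem_range.1 hk)]
    simp
  have h1 := hmono (hsub (left_mem_Icc.2 hne)) (hsub (hτ.mem 0 (by omega))) (hτ.mem 0 (by omega)).1
  have h2 := hmono (hsub (hτ.mem p le_rfl)) (hsub (right_mem_Icc.2 hne)) (hτ.mem p le_rfl).2
  have h3 := distFun_sub_le_mul_sub hf hC (hsub (left_mem_Icc.2 hne)) (hsub (right_mem_Icc.2 hne))
    hne
  have h4 : (p : ℝ) * (1 / n) ≤ C * (2 * h) := by linarith
  rw [mul_one_div, div_le_iff₀ hn'] at h4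
  linarith

/-- The first constant collects O(nh) full cells of error O((nh)⁻³). The second collects the two end
cells, of length O(1/n), where the kernel is only O(1/(nh²)). -/
lemma IsWindowPartition.abs_trapezoid_sub_integral_le {K K' g g' q' : ℝ → ℝ} {A : ℝ}
    {n p : ℕ} {h x : ℝ} {τ : ℕ → ℝ}
    (hτ : IsWindowPartition f n h x p τ) (hK : IsKernel K)
    (hKT : HasUniformTaylor K K' (Icc (-1) 1) A) (hg : HasUniformTaylor g g' (Icc 0 1) A)
    (hq : HasUniformTaylor (fun t => g t / f t) q' (Icc 0 1) A)
    (hf : ContinuousOn f (Icc 0 1)) (hfL : ∀ s ∈ Icc (0 : ℝ) 1, ∀ t ∈ Icc (0 : ℝ) 1,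
      |f t - f s| ≤ A * |t - s|)
    (hc0 : 0 < c) (hc : ∀ t ∈ Icc (0 : ℝ) 1, c ≤ f t) (hC : ∀ t ∈ Icc (0 : ℝ) 1, f t ≤ C)
    (hn : 0 < n) (hh : 0 < h) (hh1 : h < 1) (hxl : 0 < x - h) (hxr : x + h < 1) :
    |1 / (2 * (n : ℝ)) * ∑ k ∈ Finset.range p,
        (scaledKernel K x h (τ k) / f (τ k) * g (τ k) +
          scaledKernel K x h (τ (k + 1)) / f (τ (k + 1)) * g (τ (k + 1))) -
      ∫ u in (x - h)..(x + h), scaledKernel K x h u * g u|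
      ≤ (2 * C * (2 * A ^ 3 + 6 * A ^ 2 * C) / c ^ 3 + 2 * (A ^ 2 / c ^ 2)) * (1 / (n * h) ^ 2) := by
  have hn' : (0 : ℝ) < n := by exact_mod_cast hn
  have hsub : Icc (x - h) (x + h) ⊆ Icc (0 : ℝ) 1 := Icc_subset_Icc hxl.le hxr.le
  obtain ⟨hcell, hleft, hright⟩ := hτ.sub_le hf hc0 hc hn hxl hxr
  have hA : 0 ≤ A := (abs_nonneg _).trans (hg.bound 0 (by simp))
  have hC0 : 0 ≤ C := hc0.le.trans ((hc 0 (by simp)).trans (hC 0 (by simp)))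
  have hfpos {t : ℝ} (ht : t ∈ Icc (x - h) (x + h)) : 0 < f t := hc0.trans_le (hc t (hsub ht))
  have hKc : ContinuousOn (scaledKernel K x h) (Icc (x - h) (x + h)) := by
    refine continuousOn_const.mul (hK.continuousOn.comp (by fun_prop) fun u hu => ?_)
    exact sub_div_mem_Icc hh hu
  have hφg : ContinuousOn (fun u => scaledKernel K x h u * g u) (Icc (x - h) (x + h)) :=
    hKc.mul (hg.cont.mono hsub)
  have hint {a b : ℝ} (ha : a ∈ Icc (x - h) (x + h)) (hb : b ∈ Icc (x - h) (x + h)) :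
      IntervalIntegrable (fun u => scaledKernel K x h u * g u) volume a b :=
    (hφg.mono (uIcc_subset_Icc ha hb)).intervalIntegrable
  have hne : x - h ≤ x + h := by linarith
  set E := A * (2 * A ^ 2 / h ^ 2) + 2 * C * (3 * A ^ 2 / h ^ 3) with hE
  have hE0 : 0 ≤ E := by positivity
  set T : ℕ → ℝ := fun k => scaledKernel K x h (τ k) / f (τ k) * g (τ k) with hT
  have hTk (k) (hk : k < p) : |(∫ u in τ k..τ (k + 1), scaledKernel K x h u * g u) -
      1 / (2 * (n : ℝ)) * (T k + T (k + 1))| ≤ E * (1 / (c * n)) ^ 3 := by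
    have hs := hτ.mem k hk.le
    have ht := hτ.mem (k + 1) hk
    have hst := (hτ.lt k hk).le
    have hsubk : Icc (τ k) (τ (k + 1)) ⊆ Icc (x - h) (x + h) := Icc_subset_Icc hs.1 ht.2
    obtain ⟨D, hD, hDT⟩ := hKT.scaledKernel_mul hq hh hh1 hxl hxr (τ k) hs
    -- Integrating φ g / f against `f` gives back φ g, while the trapezoid weight ∫ f is exactly
    -- 1/n.
    have := abs_integral_mul_sub_trapezoid_le (f := f)
      (ψ := fun u => scaledKernel K x h u * (g u / f u)) hst (hf.mono (hsubk.trans hsub))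
      ((hKc.mono hsubk).mul (hq.cont.mono (hsubk.trans hsub)))
      (fun u hu => by rw [abs_of_pos (hfpos (hsubk hu))]; exact hC u (hsub (hsubk hu)))
      (fun u hu => hfL _ (hsub hs) u (hsub (hsubk hu)))
      (fun u hu => hDT u (hsubk hu)) (by positivity) hA hD
    rw [← distFun_sub_distFun hf (hsub hs) (hsub ht), hτ.mass k hk] at this
    have hcongr : ∫ u in τ k..τ (k + 1), scaledKernel K x h u * (g u / f u) * f u =
        ∫ u in τ k..τ (k + 1), scaledKernel K x h u * g u := by
      refine intervalIntegral.integral_congr fun u hu => ?_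
      rw [uIcc_of_le hst] at hu
      have := (hfpos (hsubk hu)).ne'
      field_simp
    rw [hcongr] at this
    calc _ = _ := by congr 2; simp only [hT]; field_simp
      _ ≤ _ := this
      _ ≤ E * (1 / (c * n)) ^ 3 := by
        have := hcell k hk
        have : 0 ≤ τ (k + 1) - τ k := sub_nonneg.2 hst
        gcongr
  have hsum : ∑ k ∈ Finset.range p, ∫ u in τ k..τ (k + 1), scaledKernel K x h u * g u =
      ∫ u in τ 0..τ p, scaledKernel K x h u * g u :=
    intervalIntegral.sum_integral_adjacent_intervals fun k hk =>
      hint (hτ.mem k hk.le) (hτ.mem (k + 1) hk)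
  have hmid : |(∫ u in τ 0..τ p, scaledKernel K x h u * g u) -
      1 / (2 * (n : ℝ)) * ∑ k ∈ Finset.range p, (T k + T (k + 1))|
      ≤ p * (E * (1 / (c * n)) ^ 3) := by
    rw [← hsum, Finset.mul_sum, ← Finset.sum_sub_distrib]
    refine (Finset.abs_sum_le_sum_abs _ _).trans ?_
    refine (Finset.sum_le_sum fun k hk => hTk k (Finset.mem_range.1 hk)).trans_eq ?_
    simp
  have hcard := hτ.card_le hf hc0 hc hC hn hxl hxr
  have hedge {a b e : ℝ} (ha : a ∈ Icc (x - h) (x + h)) (hb : b ∈ Icc (x - h) (x + h))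
      (hab : a ≤ b) (hd : b - a ≤ 1 / (c * n)) (he : |x - e| = h) (hea : e = a ∨ e = b) :
      |∫ u in a..b, scaledKernel K x h u * g u| ≤ A ^ 2 / c ^ 2 * (1 / (n * h) ^ 2) := by
    rw [← Real.norm_eq_abs]
    refine (intervalIntegral.norm_integral_le_of_norm_le_const
      (C := A * (1 / (c * n)) / h ^ 2 * A) fun u hu => ?_).trans ?_
    · rw [uIoc_of_le hab] at hu
      have hux : u ∈ Icc (x - h) (x + h) := ⟨ha.1.trans hu.1.le, hu.2.trans hb.2⟩
      have hue : |u - e| ≤ 1 / (c * n) := by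
        rw [abs_le]
        rcases hea with rfl | rfl <;> constructor <;> linarith [hu.1, hu.2]
      have h1 := hK.abs_scaledKernel_le_of_dist_le hKT hh hux he hue
      have h2 := hg.bound u (hsub hux)
      rw [Real.norm_eq_abs, abs_mul]
      gcongr
    · rw [abs_of_nonneg (sub_nonneg.2 hab)]
      calc A * (1 / (c * n)) / h ^ 2 * A * (b - a)
          ≤ A * (1 / (c * n)) / h ^ 2 * A * (1 / (c * n)) := by gcongr
        _ = _ := by field_simp
  have hL := hedge (left_mem_Icc.2 hne) (hτ.mem 0 (by omega)) (hτ.mem 0 (by omega)).1 hleft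
    (e := x - h) (by rw [sub_sub_cancel, abs_of_pos hh]) (.inl rfl)
  have hR := hedge (hτ.mem p le_rfl) (right_mem_Icc.2 hne) (hτ.mem p le_rfl).2 hright
    (e := x + h) (by rw [sub_add_cancel_left, abs_neg, abs_of_pos hh]) (.inr rfl)
  have hsplit : ∫ u in (x - h)..(x + h), scaledKernel K x h u * g u =
      (∫ u in (x - h)..τ 0, scaledKernel K x h u * g u) +
        (∫ u in τ 0..τ p, scaledKernel K x h u * g u) +
        ∫ u in τ p..(x + h), scaledKernel K x h u * g u := by
    have m0 := hτ.mem 0 (by omega)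
    have mp := hτ.mem p le_rfl
    rw [intervalIntegral.integral_add_adjacent_intervals (hint (left_mem_Icc.2 hne) m0)
      (hint m0 mp), intervalIntegral.integral_add_adjacent_intervals
        (hint (left_mem_Icc.2 hne) mp) (hint mp (right_mem_Icc.2 hne))]
  have hmid' : (p : ℝ) * (E * (1 / (c * n)) ^ 3) ≤
      2 * C * (2 * A ^ 3 + 6 * A ^ 2 * C) / c ^ 3 * (1 / (n * h) ^ 2) := by
    have hE1 : E ≤ (2 * A ^ 3 + 6 * A ^ 2 * C) / h ^ 3 := by
      have : A * (2 * A ^ 2 / h ^ 2) ≤ 2 * A ^ 3 / h ^ 3 := by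
        rw [mul_div_assoc', div_le_div_iff₀ (by positivity) (by positivity)]
        have : h ^ 3 ≤ h ^ 2 := pow_le_pow_of_le_one hh.le hh1.le (by norm_num)
        calc A * (2 * A ^ 2) * h ^ 3 ≤ A * (2 * A ^ 2) * h ^ 2 := by gcongr
          _ = _ := by ring
      rw [add_div, hE]
      refine add_le_add this (le_of_eq ?_)
      ring
    calc (p : ℝ) * (E * (1 / (c * n)) ^ 3)
        ≤ 2 * C * (n * h) * ((2 * A ^ 3 + 6 * A ^ 2 * C) / h ^ 3 * (1 / (c * n)) ^ 3) := by
          gcongr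
      _ = _ := by field_simp
  rw [hsplit]
  rw [abs_le] at hL hR hmid ⊢
  have hring : (2 * C * (2 * A ^ 3 + 6 * A ^ 2 * C) / c ^ 3 + 2 * (A ^ 2 / c ^ 2)) *
      (1 / (n * h) ^ 2) = 2 * C * (2 * A ^ 3 + 6 * A ^ 2 * C) / c ^ 3 * (1 / (n * h) ^ 2) +
      2 * (A ^ 2 / c ^ 2 * (1 / (n * h) ^ 2)) := by ring
  rw [hring]
  constructor <;> linarith [hL.1, hL.2, hR.1, hR.2, hmid.1, hmid.2]

/-- The bias of the trapezoidal estimator. -/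
lemma exists_abs_trapSum_sub_le {K g : ℝ → ℝ} (hK : IsKernel K)
    (h1 : ∫ t in (0 : ℝ)..1, f t = 1) (hf : ContDiffOn ℝ 2 f (Icc 0 1)) (hc0 : 0 < c)
    (hc : ∀ t ∈ Icc (0 : ℝ) 1, c ≤ f t) (hC : ∀ t ∈ Icc (0 : ℝ) 1, f t ≤ C)
    (hg : ContDiffOn ℝ 2 g (Icc 0 1)) :
    ∃ B, ∀ (n : ℕ) (h x : ℝ), 0 < n → 0 < h → h < 1 → 0 < x - h → x + h < 1 →
      1 ≤ n * (c * (2 * h)) →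
      |trapSum K f n h x g - g x| ≤ B * (h ^ 2 + 1 / (n * h) ^ 2) := by
  obtain ⟨K', A₁, hA₁, hKT⟩ := exists_hasUniformTaylor (by norm_num) hK.smooth.1
  obtain ⟨g', A₂, hA₂, hgT⟩ := exists_hasUniformTaylor zero_lt_one hg
  obtain ⟨q', A₃, hA₃, hqT⟩ := exists_hasUniformTaylor zero_lt_one
    (hg.div hf fun t ht => (hc0.trans_le (hc t ht)).ne')
  obtain ⟨f', A₄, hA₄, hfT⟩ := exists_hasUniformTaylor zero_lt_one hf
  set A := A₁ + A₂ + A₃ + A₄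
  have hC0 : 0 ≤ C := hc0.le.trans ((hc 0 (by simp)).trans (hC 0 (by simp)))
  have hA : 0 ≤ A := by positivity
  refine ⟨2 * A ^ 2 + (2 * C * (2 * A ^ 3 + 6 * A ^ 2 * C) / c ^ 3 + 2 * (A ^ 2 / c ^ 2)),
    fun n h x hn hh hh1 hxl hxr hnh => ?_⟩
  have hKT := hKT.mono (by simp only [A]; linarith : A₁ ≤ A)
  have hgT := hgT.mono (by simp only [A]; linarith : A₂ ≤ A)
  have hqT := hqT.mono (by simp only [A]; linarith : A₃ ≤ A)
  have hfT := hfT.mono (by simp only [A]; linarith : A₄ ≤ A)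
  obtain ⟨τ, hτ, hsum⟩ := exists_isWindowPartition hf.continuousOn h1 hc0 hc hn hh hxl hxr hnh
  have e1 := hτ.abs_trapezoid_sub_integral_le hK hKT hgT hqT hf.continuousOn hfT.lip hc0 hc hC hn hh
    hh1 hxl hxr
  rw [← hsum K g] at e1
  have e2 := hK.abs_integral_scaledKernel_mul_sub_le hKT hgT hh hxl hxr
  refine (abs_sub_le _ _ _).trans ((add_le_add e1 e2).trans ?_)
  have i1 : 0 ≤ 2 * A ^ 2 * (1 / (n * h) ^ 2) := by positivity
  have i2 : 0 ≤ (2 * C * (2 * A ^ 3 + 6 * A ^ 2 * C) / c ^ 3 + 2 * (A ^ 2 / c ^ 2)) * h ^ 2 := by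
    positivity
  linarith

/-! ### The estimator as a weighted sum -/

/-- The nodes of the trapezoidal rule, with repetitions. -/
noncomputable def node (f : ℝ → ℝ) (n : ℕ) (h x : ℝ)
    (i : Fin ((window f n h x).card - 1) × Fin 2) : ℝ :=
  windowPoint f n h x ⟨i.1 + i.2, by omega⟩

/-- The weights of the trapezoidal estimator. -/
noncomputable def nodeWeight (K f : ℝ → ℝ) (n : ℕ) (h x : ℝ)
    (i : Fin ((window f n h x).card - 1) × Fin 2) : ℝ :=
  1 / (2 * (n : ℝ)) * (scaledKernel K x h (node f n h x i) / f (node f n h x i))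

lemma trapSum_eq_sum_nodeWeight (K : ℝ → ℝ) (n : ℕ) (h x : ℝ) (y : ℝ → ℝ) :
    trapSum K f n h x y = ∑ i, nodeWeight K f n h x i * y (node f n h x i) := by
  rw [trapSum, Finset.mul_sum, Fintype.sum_prod_type]
  refine Finset.sum_congr rfl fun k _ => ?_
  rw [Fin.sum_univ_two]
  simp only [nodeWeight, node, Fin.val_zero, Fin.val_one, add_zero]
  ring

lemma node_mem_window {n : ℕ} {h x : ℝ} (i : Fin ((window f n h x).card - 1) × Fin 2) :
    node f n h x i ∈ window f n h x :=
  windowPoint_mem _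

/-- There are O(nh) nodes, each with weight O(1/(nh)). -/
lemma exists_sum_abs_nodeWeight_le {K : ℝ → ℝ} (hK : IsKernel K)
    (h1 : ∫ t in (0 : ℝ)..1, f t = 1) (hf : ContinuousOn f (Icc 0 1)) (hc0 : 0 < c)
    (hc : ∀ t ∈ Icc (0 : ℝ) 1, c ≤ f t) (hC : ∀ t ∈ Icc (0 : ℝ) 1, f t ≤ C) :
    ∃ B, ∀ (n : ℕ) (h x : ℝ), 0 < n → 0 < h → 0 < x - h → x + h < 1 →
      1 ≤ n * (c * (2 * h)) → ∑ i, |nodeWeight K f n h x i| ≤ B := by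
  obtain ⟨K', A, hA, hKT⟩ := exists_hasUniformTaylor (by norm_num) hK.smooth.1
  refine ⟨2 * C * A / c, fun n h x hn hh hxl hxr hnh => ?_⟩
  have hn' : (0 : ℝ) < n := by exact_mod_cast hn
  obtain ⟨τ, hτ, -⟩ := exists_isWindowPartition hf h1 hc0 hc hn hh hxl hxr hnh
  have hcard := hτ.card_le hf hc0 hc hC hn hxl hxr
  have hle (i) : |nodeWeight K f n h x i| ≤ 1 / (2 * n) * (A / h / c) := by
    have hm := node_mem_window i
    have h01 := mem_Icc_of_mem_window hf h1 hm
    have hfc := hc _ h01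
    rw [nodeWeight, abs_mul, abs_of_pos (by positivity), abs_div,
      abs_of_pos (hc0.trans_le hfc)]
    have := abs_scaledKernel_le hKT hh (mem_window.1 hm).2
    gcongr
  calc ∑ i, |nodeWeight K f n h x i|
      ≤ ∑ i : Fin ((window f n h x).card - 1) × Fin 2, 1 / (2 * n) * (A / h / c) :=
        Finset.sum_le_sum fun i _ => hle i
    _ = ((window f n h x).card - 1 : ℕ) * (1 / n * (A / h / c)) := by
        simp only [Finset.sum_const, Finset.card_univ, Fintype.card_prod, Fintype.card_fin,
          nsmul_eq_mul]
        push_cast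
        field_simp
    _ ≤ 2 * C * (n * h) * (1 / n * (A / h / c)) := by gcongr
    _ = _ := by field_simp

end Window

end TrapReg
namespace TrapReg

/-! ### Second moments of the stochastic part -/

variable {Ω : Type*} [MeasurableSpace Ω] {P : Measure Ω}

/-- A Cauchy–Schwarz bound for the second moment of a weighted sum. -/
lemma integral_sq_sum_mul_le {ι : Type*} [Fintype ι] {a : ι → ℝ} {X : ι → Ω → ℝ} {B η : ℝ}
    (hX : ∀ i, MemLp (X i) 2 P) (hB : ∑ i, |a i| ≤ B) (hη0 : 0 ≤ η)
    (hη : ∀ i, ∫ ω, X i ω ^ 2 ∂P ≤ η) :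
    ∫ ω, (∑ i, a i * X i ω) ^ 2 ∂P ≤ B ^ 2 * η := by
  have hint : Integrable (fun ω => (∑ i, |a i|) * ∑ i, |a i| * X i ω ^ 2) P :=
    (integrable_finsetSum _ fun i _ => (hX i).integrable_sq.const_mul _).const_mul _
  have hs0 : 0 ≤ ∑ i, |a i| := Finset.sum_nonneg fun i _ => abs_nonneg _
  calc ∫ ω, (∑ i, a i * X i ω) ^ 2 ∂P
      ≤ ∫ ω, (∑ i, |a i|) * ∑ i, |a i| * X i ω ^ 2 ∂P := by
        refine integral_mono_of_nonneg (.of_forall fun ω => sq_nonneg _) hint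
          (.of_forall fun ω => ?_)
        -- Cauchy–Schwarz for the pair |a| and |a| X², whose product is (a X)².
        refine Finset.sum_sq_le_sum_mul_sum_of_sq_le_mul _ (fun i _ => abs_nonneg _)
          (fun i _ => by positivity) fun i _ => ?_
        rw [mul_pow, ← sq_abs (a i)]
        exact le_of_eq (by ring)
    _ = (∑ i, |a i|) * ∑ i, |a i| * ∫ ω, X i ω ^ 2 ∂P := by
        rw [integral_const_mul, integral_finsetSum _ fun i _ => (hX i).integrable_sq.const_mul _]
        simp_rw [integral_const_mul]
    _ ≤ (∑ i, |a i|) * ∑ i, |a i| * η := by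
        gcongr with i
        exact hη i
    _ = (∑ i, |a i|) ^ 2 * η := by rw [← Finset.sum_mul]; ring
    _ ≤ B ^ 2 * η := by gcongr

/-- Normalized sums of a triangular array with independent, identically distributed, centered rows
vanish in probability when the variances do. -/
lemma tendstoInMeasure_inv_sqrt_mul_sum [IsProbabilityMeasure P] {D : ℕ → ℕ → Ω → ℝ} (m : ℕ → ℕ)
    (hD : ∀ k j, MemLp (D k j) 2 P) (h0 : ∀ k j, ∫ ω, D k j ω ∂P = 0)
    (hindep : ∀ k, iIndepFun (D k) P) (hident : ∀ k j, IdentDistrib (D k j) (D k 0) P P)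
    (hlim : Tendsto (fun k => ∫ ω, D k 0 ω ^ 2 ∂P) atTop (𝓝 0)) :
    TendstoInMeasure P (fun k ω => (√(m k : ℝ))⁻¹ * ∑ j ∈ Finset.range (m k), D k j ω) atTop
      (fun _ => 0) := by
  set S : ℕ → Ω → ℝ := fun k ω => (√(m k : ℝ))⁻¹ * ∑ j ∈ Finset.range (m k), D k j ω with hS
  have hSL (k) : MemLp (S k) 2 P := (memLp_finsetSum _ fun j _ => hD k j).const_mul _
  have hS0 (k) : ∫ ω, S k ω ∂P = 0 := by
    simp only [hS]
    rw [integral_const_mul, integral_finsetSum _ fun j _ => (hD k j).integrable (by norm_num)]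
    simp [h0]
  have hvar (k) : Var[S k; P] ≤ ∫ ω, D k 0 ω ^ 2 ∂P := by
    have hv0 : Var[D k 0; P] = ∫ ω, D k 0 ω ^ 2 ∂P :=
      variance_of_integral_eq_zero (hD k 0).aemeasurable (h0 k 0)
    have hsum : Var[∑ j ∈ Finset.range (m k), D k j; P] = m k * ∫ ω, D k 0 ω ^ 2 ∂P := by
      rw [IndepFun.variance_sum (fun j _ => hD k j)
        fun i _ j _ hij => (hindep k).indepFun hij, Finset.sum_congr rfl
        fun j _ => (hident k j).variance_eq.trans hv0]
      simp
    have hSeq : S k = fun ω => (√(m k : ℝ))⁻¹ * (∑ j ∈ Finset.range (m k), D k j) ω := by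
      ext ω; simp [hS]
    rw [hSeq, variance_const_mul, hsum, inv_pow, Real.sq_sqrt (by positivity), ← mul_assoc]
    refine mul_le_of_le_one_left (integral_nonneg fun ω => sq_nonneg _) ?_
    -- An inequality, not an equality, because `m k = 0` is allowed.
    exact inv_mul_le_one
  rw [tendstoInMeasure_iff_norm]
  intro δ hδ
  have hup : Tendsto (fun k => ENNReal.ofReal ((∫ ω, D k 0 ω ^ 2 ∂P) / δ ^ 2)) atTop (𝓝 0) := by
    have := ENNReal.tendsto_ofReal (hlim.div_const (δ ^ 2))
    simpa using this
  refine tendsto_of_tendsto_of_tendsto_of_le_of_le tendsto_const_nhds hup (fun _ => zero_le)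
    fun k => ?_
  have := meas_ge_le_variance_div_sq (hSL k) hδ
  rw [hS0 k] at this
  simp only [sub_zero] at this ⊢
  exact this.trans (ENNReal.ofReal_le_ofReal (by gcongr; exact hvar k))

namespace IsErrorModel

variable {ε : ℕ → ℝ → Ω → ℝ}

lemma autocov_eq (hε : IsErrorModel P ε) {s t : ℝ} (hs : s ∈ Icc (0 : ℝ) 1)
    (ht : t ∈ Icc (0 : ℝ) 1) : autocov P ε s t = ∫ ω, ε 0 s ω * ε 0 t ω ∂P := by
  rw [autocov, covariance, hε.centered 0 s hs, hε.centered 0 t ht]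
  simp

lemma integral_sub_sq (hε : IsErrorModel P ε) {s t : ℝ} (hs : s ∈ Icc (0 : ℝ) 1)
    (ht : t ∈ Icc (0 : ℝ) 1) : ∫ ω, (ε 0 s ω - ε 0 t ω) ^ 2 ∂P =
      autocov P ε s s - 2 * autocov P ε s t + autocov P ε t t := by
  have i {u v : ℝ} (hu : u ∈ Icc (0 : ℝ) 1) (hv : v ∈ Icc (0 : ℝ) 1) :
      Integrable (fun ω => ε 0 u ω * ε 0 v ω) P :=
    (hε.second_order 0 u hu).integrable_mul (hε.second_order 0 v hv)
  have hexp : (fun ω => (ε 0 s ω - ε 0 t ω) ^ 2) =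
      fun ω => ε 0 s ω * ε 0 s ω - 2 * (ε 0 s ω * ε 0 t ω) + ε 0 t ω * ε 0 t ω := by
    ext ω; ring
  have hadd := integral_add ((i hs hs).sub ((i hs ht).const_mul 2)) (i ht ht)
  simp only [Pi.sub_apply] at hadd
  rw [hexp, hadd, integral_sub (i hs hs) ((i hs ht).const_mul 2), integral_const_mul,
    hε.autocov_eq hs hs,
    hε.autocov_eq hs ht, hε.autocov_eq ht ht]

/-- Continuity of the autocovariance function gives mean square continuity of the errors. -/
lemma exists_integral_sub_sq_le (hε : IsErrorModel P ε)
    (hR : ContinuousOn (fun p : ℝ × ℝ => autocov P ε p.1 p.2) (Icc (0 : ℝ) 1 ×ˢ Icc (0 : ℝ) 1))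
    {x : ℝ} (hx : x ∈ Icc (0 : ℝ) 1) {η : ℝ} (hη : 0 < η) :
    ∃ δ > 0, ∀ t ∈ Icc (0 : ℝ) 1, |t - x| < δ → ∫ ω, (ε 0 t ω - ε 0 x ω) ^ 2 ∂P ≤ η := by
  have h1 : ContinuousOn (fun t => autocov P ε t t) (Icc 0 1) :=
    hR.comp (continuousOn_id.prodMk continuousOn_id) fun t ht => ⟨ht, ht⟩
  have h2 : ContinuousOn (fun t => autocov P ε t x) (Icc 0 1) :=
    hR.comp (continuousOn_id.prodMk continuousOn_const) fun t ht => ⟨ht, hx⟩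
  have h3 : ContinuousOn (fun t => autocov P ε t t - 2 * autocov P ε t x + autocov P ε x x)
      (Icc 0 1) := (h1.sub (h2.const_mul 2)).add continuousOn_const
  obtain ⟨δ, hδ, hlt⟩ := Metric.continuousOn_iff.1 h3 x hx η hη
  refine ⟨δ, hδ, fun t ht htx => ?_⟩
  have := hlt t ht htx
  rw [hε.integral_sub_sq ht hx]
  rw [Real.dist_eq] at this
  linarith [le_abs_self (autocov P ε t t - 2 * autocov P ε t x + autocov P ε x x -
    (autocov P ε x x - 2 * autocov P ε x x + autocov P ε x x))]

end IsErrorModel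

/-- The contribution of the `j`-th experimental unit to the stochastic part of the estimator, minus
its limit `ε j x`. -/
noncomputable def smoothingError {Ω' : Type*} (K f : ℝ → ℝ) (ε : ℕ → ℝ → Ω' → ℝ) (n : ℕ)
    (h x : ℝ) (j : ℕ) (ω : Ω') : ℝ :=
  trapSum K f n h x (fun t => ε j t ω) - ε j x ω

namespace IsErrorModel

variable {ε : ℕ → ℝ → Ω → ℝ} {f : ℝ → ℝ} {x : ℝ}

lemma memLp_smoothingError (hε : IsErrorModel P ε) (hf : ContinuousOn f (Icc 0 1))
    (h1 : ∫ t in (0 : ℝ)..1, f t = 1) (hx : x ∈ Icc (0 : ℝ) 1) (K : ℝ → ℝ) (n : ℕ) (h : ℝ)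
    (j : ℕ) : MemLp (smoothingError K f ε n h x j) 2 P := by
  unfold smoothingError
  simp_rw [trapSum_eq_sum_nodeWeight]
  exact (memLp_finsetSum _ fun i _ => (hε.second_order j _
    (mem_Icc_of_mem_window hf h1 (node_mem_window i))).const_mul _).sub (hε.second_order j x hx)

lemma integral_smoothingError (hε : IsErrorModel P ε) [IsProbabilityMeasure P]
    (hf : ContinuousOn f (Icc 0 1))
    (h1 : ∫ t in (0 : ℝ)..1, f t = 1) (hx : x ∈ Icc (0 : ℝ) 1) (K : ℝ → ℝ) (n : ℕ) (h : ℝ)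
    (j : ℕ) : ∫ ω, smoothingError K f ε n h x j ω ∂P = 0 := by
  have hm (i) := mem_Icc_of_mem_window hf h1 (node_mem_window (f := f) (n := n) (h := h) (x := x) i)
  have hint {t : ℝ} (ht : t ∈ Icc (0 : ℝ) 1) : Integrable (ε j t) P :=
    (hε.second_order j t ht).integrable (by norm_num)
  unfold smoothingError
  simp_rw [trapSum_eq_sum_nodeWeight]
  rw [integral_sub (integrable_finsetSum _ fun i _ => (hint (hm i)).const_mul _) (hint hx),
    integral_finsetSum _ fun i _ => (hint (hm i)).const_mul _, hε.centered j x hx]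
  simp_rw [integral_const_mul, hε.centered j _ (hm _)]
  simp

/-- One measurable functional serves every `j`, so independence and equality in law pass from the
paths to the smoothing errors. -/
lemma exists_smoothingError_eq_comp (hf : ContinuousOn f (Icc 0 1))
    (h1 : ∫ t in (0 : ℝ)..1, f t = 1) (hx : x ∈ Icc (0 : ℝ) 1) (K : ℝ → ℝ) (n : ℕ) (h : ℝ)
    {Ω' : Type*} (ε : ℕ → ℝ → Ω' → ℝ) :
    ∃ Φ : (Icc (0 : ℝ) 1 → ℝ) → ℝ, Measurable Φ ∧ ∀ j, smoothingError K f ε n h x j =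
      Φ ∘ fun (ω : Ω') (t : Icc (0 : ℝ) 1) => ε j t ω := by
  have hm (i) := mem_Icc_of_mem_window hf h1 (node_mem_window (f := f) (n := n) (h := h) (x := x) i)
  refine ⟨fun e => ∑ i, nodeWeight K f n h x i * e ⟨node f n h x i, hm i⟩ - e ⟨x, hx⟩,
    by fun_prop, fun j => ?_⟩
  ext ω
  simp [smoothingError, trapSum_eq_sum_nodeWeight]

lemma iIndepFun_smoothingError (hε : IsErrorModel P ε) (hf : ContinuousOn f (Icc 0 1))
    (h1 : ∫ t in (0 : ℝ)..1, f t = 1) (hx : x ∈ Icc (0 : ℝ) 1) (K : ℝ → ℝ) (n : ℕ) (h : ℝ) :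
    iIndepFun (smoothingError K f ε n h x) P := by
  obtain ⟨Φ, hΦ, heq⟩ := exists_smoothingError_eq_comp hf h1 hx K n h ε
  rw [funext heq]
  exact hε.indep.comp (fun _ => Φ) fun _ => hΦ

lemma identDistrib_smoothingError (hε : IsErrorModel P ε) (hf : ContinuousOn f (Icc 0 1))
    (h1 : ∫ t in (0 : ℝ)..1, f t = 1) (hx : x ∈ Icc (0 : ℝ) 1) (K : ℝ → ℝ) (n : ℕ) (h : ℝ) (j : ℕ) :
    IdentDistrib (smoothingError K f ε n h x j) (smoothingError K f ε n h x 0) P P := by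
  obtain ⟨Φ, hΦ, heq⟩ := exists_smoothingError_eq_comp hf h1 hx K n h ε
  rw [heq, heq]
  exact (hε.ident j).comp hΦ

/-- With weights wᵢ at nodes tᵢ, the smoothing error is Σ wᵢ (ε(tᵢ) − ε(x)) plus (Σ wᵢ − 1) ε(x).
The first part is controlled by mean square continuity, the second by the defect of the total
weight. -/
lemma integral_smoothingError_sq_le (hε : IsErrorModel P ε) [IsProbabilityMeasure P]
    (hf : ContinuousOn f (Icc 0 1)) (h1 : ∫ t in (0 : ℝ)..1, f t = 1) (hx : x ∈ Icc (0 : ℝ) 1)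
    {K : ℝ → ℝ} {n : ℕ} {h B η : ℝ} (hB : ∑ i, |nodeWeight K f n h x i| ≤ B) (hη0 : 0 ≤ η)
    (hη : ∀ t ∈ Icc (0 : ℝ) 1, |t - x| ≤ h → ∫ ω, (ε 0 t ω - ε 0 x ω) ^ 2 ∂P ≤ η) :
    ∫ ω, smoothingError K f ε n h x 0 ω ^ 2 ∂P ≤
      2 * (B ^ 2 * η) + 2 * ((trapSum K f n h x (fun _ => 1) - 1) ^ 2 * autocov P ε x x) := by
  have hw (i) := node_mem_window (f := f) (n := n) (h := h) (x := x) i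
  have hm (i) := mem_Icc_of_mem_window hf h1 (hw i)
  set U : Ω → ℝ := fun ω => ∑ i, nodeWeight K f n h x i * (ε 0 (node f n h x i) ω - ε 0 x ω)
  set r : ℝ := trapSum K f n h x (fun _ => 1) - 1
  have hdiff (i) : MemLp (fun ω => ε 0 (node f n h x i) ω - ε 0 x ω) 2 P :=
    (hε.second_order 0 _ (hm i)).sub (hε.second_order 0 x hx)
  have hU : MemLp U 2 P := memLp_finsetSum _ fun i _ => (hdiff i).const_mul _
  have hUle : ∫ ω, U ω ^ 2 ∂P ≤ B ^ 2 * η := by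
    refine integral_sq_sum_mul_le hdiff hB hη0 fun i => hη _ (hm i) ?_
    have := (mem_window.1 (hw i)).2
    rw [abs_le]
    constructor <;> linarith
  have hdecomp (ω) : smoothingError K f ε n h x 0 ω = U ω + r * ε 0 x ω := by
    simp only [smoothingError, trapSum_eq_sum_nodeWeight, U, r, mul_sub, Finset.sum_sub_distrib,
      mul_one, ← Finset.sum_mul]
    ring
  have hV : Integrable (fun ω => ε 0 x ω * ε 0 x ω) P :=
    (hε.second_order 0 x hx).integrable_mul (hε.second_order 0 x hx)
  calc ∫ ω, smoothingError K f ε n h x 0 ω ^ 2 ∂P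
      ≤ ∫ ω, (2 * U ω ^ 2 + 2 * r ^ 2 * (ε 0 x ω * ε 0 x ω)) ∂P := by
        refine integral_mono_of_nonneg (.of_forall fun ω => sq_nonneg _)
          ((hU.integrable_sq.const_mul 2).add (hV.const_mul _)) (.of_forall fun ω => ?_)
        simp only [hdecomp]
        linarith [sq_nonneg (U ω - r * ε 0 x ω)]
    _ = 2 * ∫ ω, U ω ^ 2 ∂P + 2 * r ^ 2 * autocov P ε x x := by
        rw [integral_add (hU.integrable_sq.const_mul 2) (hV.const_mul _), integral_const_mul,
          integral_const_mul, hε.autocov_eq hx hx]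
    _ ≤ _ := by linarith

/-- The central limit theorem for the errors at a point. -/
lemma tendstoInDistribution_inv_sqrt_mul_sum (hε : IsErrorModel P ε) [IsProbabilityMeasure P]
    (hx : x ∈ Icc (0 : ℝ) 1) {m : ℕ → ℕ} (hm : Tendsto m atTop atTop) :
    TendstoInDistribution (fun k ω => (√(m k : ℝ))⁻¹ * ∑ j ∈ Finset.range (m k), ε j x ω) atTop
      (id : ℝ → ℝ) (fun _ => P) (gaussianReal 0 (autocov P ε x x).toNNReal) := by
  have hvar : autocov P ε x x = Var[ε 0 x; P] :=
    covariance_self (hε.second_order 0 x hx).aemeasurable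
  have hΦ : Measurable fun e : Icc (0 : ℝ) 1 → ℝ => e ⟨x, hx⟩ := measurable_pi_apply _
  have hclt := tendstoInDistribution_inv_sqrt_mul_sum_sub (P := P) (X := fun j => ε j x)
    (Y := (id : ℝ → ℝ)) (P' := gaussianReal 0 (autocov P ε x x).toNNReal)
    (by rw [hvar]; exact HasLaw.id) (hε.second_order 0 x hx)
    (hε.indep.comp (fun _ e => e ⟨x, hx⟩) fun _ => hΦ) fun j => (hε.ident j).comp hΦ
  simp only [hε.centered 0 x hx, mul_zero, sub_zero] at hclt
  -- The limit along all sample sizes is composed with `m`, which tends to infinity.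
  exact ⟨fun k => hclt.forall_aemeasurable (m k), hclt.aemeasurable_limit, hclt.tendsto.comp hm⟩

end IsErrorModel

lemma sqrt_mul_trapEstimator_sub {Ω' : Type*} (K f g : ℝ → ℝ) (ε : ℕ → ℝ → Ω' → ℝ) (n m : ℕ)
    (h x : ℝ) (ω : Ω') :
    √(m : ℝ) * (trapEstimator K f g ε n m h x ω - g x) =
      (√(m : ℝ))⁻¹ * ∑ j ∈ Finset.range m, ε j x ω +
      (√(m : ℝ))⁻¹ * ∑ j ∈ Finset.range m, smoothingError K f ε n h x j ω +
      √(m : ℝ) * (trapSum K f n h x g - g x) := by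
  rcases Nat.eq_zero_or_pos m with rfl | hm
  · simp
  have hm' : (0 : ℝ) < m := by exact_mod_cast hm
  have hest : trapEstimator K f g ε n m h x ω = trapSum K f n h x (fun t => meanObs g ε m t ω) := rfl
  have hmean (t : ℝ) : meanObs g ε m t ω = g t + (m : ℝ)⁻¹ * ∑ j ∈ Finset.range m, ε j t ω := by
    simp only [meanObs, obs, Finset.sum_add_distrib, Finset.sum_const, Finset.card_range,
      nsmul_eq_mul]
    field_simp
  have hsq : √(m : ℝ) * (m : ℝ)⁻¹ = (√(m : ℝ))⁻¹ := by
    rw [← div_eq_mul_inv, Real.sqrt_div_self]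
  have hlin : trapSum K f n h x (fun t => meanObs g ε m t ω) = trapSum K f n h x g +
      (m : ℝ)⁻¹ * ∑ j ∈ Finset.range m, trapSum K f n h x (fun t => ε j t ω) := by
    simp only [trapSum_eq_sum_nodeWeight, hmean, mul_add, Finset.sum_add_distrib]
    congr 1
    rw [Finset.sum_comm, Finset.mul_sum]
    refine Finset.sum_congr rfl fun i _ => ?_
    rw [← Finset.mul_sum]
    ring
  rw [hest, hlin]
  simp only [smoothingError, Finset.sum_sub_distrib]
  rw [← hsq]
  ring

end TrapReg
-- Conclusion by Slutsky's lemma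
theorem theorem3 {Ω : Type*} [MeasurableSpace Ω] (P : Measure Ω) [IsProbabilityMeasure P]
    (ε : ℕ → ℝ → Ω → ℝ) (g f K : ℝ → ℝ)
    (hε : TrapReg.IsErrorModel P ε)
    (hR : TrapReg.IsRegularCov (TrapReg.autocov P ε))
    (hK : TrapReg.IsKernel K)
    (hf : TrapReg.IsDesignDensity f)
    (hf2 : TrapReg.IsC2Lipschitz 0 1 f)
    (hg2 : TrapReg.IsC2Lipschitz 0 1 g)
    (n m : ℕ → ℕ) (h : ℕ → ℝ)
    (hn : Tendsto n atTop atTop) (hm : Tendsto m atTop atTop)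
    (hpos : ∀ k, 0 < h k ∧ h k < 1)
    (hh : Tendsto h atTop (𝓝 0))
    (hnh : Tendsto (fun k => (n k : ℝ) * h k) atTop atTop)
    (hmh2 : Tendsto (fun k => √(m k : ℝ) * h k ^ 2) atTop (𝓝 0))
    (hnh2 : Tendsto (fun k => (n k : ℝ) * h k ^ 2) atTop atTop)
    (x : ℝ) (hx : x ∈ Ioo (0 : ℝ) 1) :
    TendstoInDistribution
      (fun k ω => √(m k : ℝ) * (TrapReg.trapEstimator K f g ε (n k) (m k) (h k) x ω - g x))
      atTop (id : ℝ → ℝ) (fun _ => P)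
      (gaussianReal 0 (TrapReg.autocov P ε x x).toNNReal) := by
  have hxI : x ∈ Icc (0 : ℝ) 1 := Ioo_subset_Icc_self hx
  have h1 := hf.integral_eq_one
  have hfc := hf2.1.continuousOn
  obtain ⟨c, hc0, hc⟩ := hf.bounded_below
  obtain ⟨C, hC⟩ := hf.bounded_above
  -- Eventually the window is interior and nonempty, and nh² ≥ 1 makes the quadrature error at most
  -- of the order of the smoothing bias.
  have hgood : ∀ᶠ k in atTop, 0 < n k ∧ 0 < x - h k ∧ x + h k < 1 ∧
      1 ≤ n k * (c * (2 * h k)) ∧ 1 / ((n k : ℝ) * h k) ^ 2 ≤ h k ^ 2 := by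
    filter_upwards [hn.eventually_gt_atTop 0, hh.eventually_lt_const hx.1,
      hh.eventually_lt_const (sub_pos.2 hx.2), hnh.eventually_ge_atTop (1 / (2 * c)),
      hnh2.eventually_ge_atTop 1] with k h1 h2 h3 h4 h5
    have hk := (hpos k).1
    have hnk : (0 : ℝ) < n k := by exact_mod_cast h1
    refine ⟨h1, by linarith, by linarith, ?_, ?_⟩
    · rw [div_le_iff₀ (by positivity)] at h4
      linarith
    · rw [div_le_iff₀ (by positivity)]
      calc (1 : ℝ) ≤ (n k * h k ^ 2) ^ 2 := one_le_pow₀ h5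
        _ = _ := by ring
  have hbias {u : ℝ → ℝ} (hu : ContDiffOn ℝ 2 u (Icc 0 1)) : ∃ B, ∀ᶠ k in atTop,
      |TrapReg.trapSum K f (n k) (h k) x u - u x| ≤ B * h k ^ 2 := by
    obtain ⟨B, hB⟩ := TrapReg.exists_abs_trapSum_sub_le hK h1 hf2.1 hc0 hc hC hu
    refine ⟨2 * |B|, ?_⟩
    filter_upwards [hgood] with k ⟨g1, g2, g3, g4, g5⟩
    refine (hB _ _ _ g1 (hpos k).1 (hpos k).2 g2 g3 g4).trans ?_
    calc B * (h k ^ 2 + 1 / (n k * h k) ^ 2) ≤ |B| * (h k ^ 2 + 1 / (n k * h k) ^ 2) := by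
          gcongr; exact le_abs_self B
      _ ≤ |B| * (h k ^ 2 + h k ^ 2) := by gcongr
      _ = _ := by ring
  have hbias_g : Tendsto (fun k => √(m k : ℝ) * (TrapReg.trapSum K f (n k) (h k) x g - g x)) atTop
      (𝓝 0) := by
    obtain ⟨B, hB⟩ := hbias hg2.1
    refine squeeze_zero_norm' (a := fun k => B * (√(m k : ℝ) * h k ^ 2)) ?_ (by
      simpa using hmh2.const_mul B)
    filter_upwards [hB] with k hk
    rw [Real.norm_eq_abs, abs_mul, abs_of_nonneg (Real.sqrt_nonneg _)]
    calc _ ≤ √(m k : ℝ) * (B * h k ^ 2) := by gcongr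
      _ = _ := by ring
  -- Applied to the constant function 1, the bias bound says that the total weight tends to 1.
  have hbias_one : Tendsto (fun k => TrapReg.trapSum K f (n k) (h k) x (fun _ => 1) - 1) atTop
      (𝓝 0) := by
    obtain ⟨B, hB⟩ := hbias (u := fun _ => 1) contDiffOn_const
    refine squeeze_zero_norm' (a := fun k => B * h k ^ 2) hB ?_
    simpa using (hh.pow 2).const_mul B
  have hlim : Tendsto (fun k => ∫ ω, TrapReg.smoothingError K f ε (n k) (h k) x 0 ω ^ 2 ∂P) atTop
      (𝓝 0) := by
    obtain ⟨B, hB⟩ := TrapReg.exists_sum_abs_nodeWeight_le hK h1 hfc hc0 hc hC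
    refine tendsto_order.2 ⟨fun a ha => .of_forall fun k =>
      ha.trans_le (integral_nonneg fun ω => sq_nonneg _), fun e he => ?_⟩
    -- Chosen so that 2B²η ≤ e/2; the summand 1 guards against B = 0.
    have hη : 0 < e / (4 * (B ^ 2 + 1)) := by positivity
    obtain ⟨δ, hδ, hδle⟩ := hε.exists_integral_sub_sq_le hR.cont hxI hη
    have hrest : Tendsto (fun k => 2 * ((TrapReg.trapSum K f (n k) (h k) x (fun _ => 1) - 1) ^ 2 *
        TrapReg.autocov P ε x x)) atTop (𝓝 0) := by
      simpa using ((hbias_one.pow 2).mul_const (TrapReg.autocov P ε x x)).const_mul 2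
    filter_upwards [hgood, hh.eventually_lt_const hδ, hrest.eventually_lt_const (half_pos he)]
      with k ⟨g1, g2, g3, g4, g5⟩ hkδ hkr
    have hle := hε.integral_smoothingError_sq_le hfc h1 hxI
      (hB (n k) (h k) x g1 (hpos k).1 g2 g3 g4) hη.le
      fun t ht htx => hδle t ht (htx.trans_lt hkδ)
    have hBe : 2 * (B ^ 2 * (e / (4 * (B ^ 2 + 1)))) ≤ e / 2 := by
      rw [mul_div_assoc', mul_div_assoc', div_le_div_iff₀ (by positivity) (by positivity)]
      nlinarith
    linarith
  have hS := TrapReg.tendstoInMeasure_inv_sqrt_mul_sum m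
    (fun k j => hε.memLp_smoothingError hfc h1 hxI K (n k) (h k) j)
    (fun k j => hε.integral_smoothingError hfc h1 hxI K (n k) (h k) j)
    (fun k => hε.iIndepFun_smoothingError hfc h1 hxI K (n k) (h k))
    (fun k j => hε.identDistrib_smoothingError hfc h1 hxI K (n k) (h k) j) hlim
  have hSmeas (k) : AEMeasurable (fun ω => (√(m k : ℝ))⁻¹ *
      ∑ j ∈ Finset.range (m k), TrapReg.smoothingError K f ε (n k) (h k) x j ω) P :=
    (Finset.aemeasurable_fun_sum _ fun j _ =>
      (hε.memLp_smoothingError hfc h1 hxI K (n k) (h k) j).aemeasurable).const_mul _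
  have hconst : TendstoInMeasure P (fun k (_ : Ω) =>
      √(m k : ℝ) * (TrapReg.trapSum K f (n k) (h k) x g - g x)) atTop (fun _ => 0) :=
    tendstoInMeasure_of_tendsto_ae (fun _ => aestronglyMeasurable_const)
      (.of_forall fun _ => hbias_g)
  have hsum := ((hε.tendstoInDistribution_inv_sqrt_mul_sum hxI hm).add_of_tendstoInMeasure_const
    hS hSmeas).add_of_tendstoInMeasure_const hconst fun _ => aemeasurable_const
  refine hsum.congr (fun k => .of_forall fun ω => ?_) (.of_forall fun y => ?_)
  · exact (TrapReg.sqrt_mul_trapEstimator_sub K f g ε (n k) (m k) (h k) x ω).symm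
  · simp
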